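/- Let $X$ be a CAT(0) space and let a group $H$ act properly, freely and by isometries on $X$. Let $C\subset X$ be a closed, convex, $H$-invariant subset on which $H$ acts cocompactly, let $\epsilon>0$, and let $C_\epsilon=\{x : d(x,C)\le\epsilon\}$. Let $\Sigma_\epsilon$ be an $H$-invariant connected component of the topological boundary $\partial C_\epsilon$ and let $Y_\epsilon$ be a connected component of $X\setminus C_\epsilon$ bounded by $\Sigma_\epsilon$, i.e. with $\partial Y_\epsilon\cap\Sigma_\epsilon\neq\emptyset$. If there is $\lambda\in[\frac12,1)$ such that $C_\epsilon$ has $\lambda$-barycenters up to $H$ in the sense defined below, then $\Sigma_\epsilon$ is contractible. Notation. $N_R(A)=\{x : d(x,A)\le R\}$; $HA=\bigcup_{h\in H}hA$ for $A\subset X$, and $H\mathcal U=\{hU : h\in H, U\in\mathcal U\}$ for a family $\mathcal U$ of subsets of $X$. For $q\in\Sigma_\epsilon$ and $q'\neq q$ in $X$, $\angle_q(q',C)$ is the Alexandrov angle at $q$ between the geodesics from $q$ to $q'$ and from $q$ to the point of $C$ closest to $q$. For a family $\mathcal V$ of subsets of $X$, finitely many members of $\mathcal V$ span a simplex of the nerve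 of $\mathcal V$ if their intersection is non-empty. A subset $Z\subset X$ *has $\lambda$-barycenters up to diameter $\Delta$* if for all finite $P,Q\subset Z$ with $P\ne\emptyset$, $\operatorname{diam}(P)\le\Delta$ and $\operatorname{diam}(P\cup Q)\le2\Delta$ there is $b\in Z$ with $d(b,p)\le\lambda\operatorname{diam}(P)$ for all $p\in P$ and $d(b,q)\le\operatorname{diam}(\{q\}\cup P)$ for all $q\in Q$. *$C_\epsilon$ has $\lambda$-barycenters up to $H$* if there are a compact $K\subset C_\epsilon$ with $HK=C_\epsilon$, a compact $K_{out}\subset Y_\epsilon$, numbers $\alpha>\frac\pi2$ and $\delta,\delta'>0$, a finite cover $\mathcal U$ of $K$ by open subsets of $X$ of diameter at most $\delta$, an $H$-invariant set $Z\subset X$ and an $H$-equivariant map $\iota:H\mathcal U\to HK_{out}\cap Y_\epsilon$ such that: 1. ($(\delta,\delta')$ is small relative to $K,K_{out},\alpha$.) If $hK\cap K=\emptyset$, then $\inf\{d(p,q) : p\in K, q\in hK\}>2\delta$; $N_{\delta'}(K_{out})\cap C_\epsilon=\emptyset$; and $|\angle_{q_1}(q_1',C)-\angle_{q_2}(q_2',C)|\le\frac\alpha2-\frac\pi4$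 for all $q_1,q_2\in N_\delta(K)\cap\Sigma_\epsilon$ and $q_1',q_2'\in N_{\delta'}(K_{out})$ with $d(q_1,q_2)\le\delta$ and $d(q_1',q_2')\le\delta'$. 2. $HK_{out}\subset Z\subset Y_{\epsilon+\delta'}$ for some connected component $Y_{\epsilon+\delta'}$ of $X\setminus C_{\epsilon+\delta'}$ that meets $Y_\epsilon$, where $C_{\epsilon+\delta'}=N_{\epsilon+\delta'}(C)$; and $Z$ has $\lambda$-barycenters up to diameter $\operatorname{diam}_K(K_{out}):=\sup\{\operatorname{diam}(hK_{out}\cup K_{out}) : h\in H, hK\cap K\neq\emptyset\}$. 3. ($\iota$ is a $(\mathcal U,\alpha)$-push-off grid.) $U\cap hU=\emptyset$ for all $U\in\mathcal U$ and $h\in H\setminus\{1\}$; $\iota(U)\in K_{out}$ for all $U\in\mathcal U$; and every $U\in\mathcal U$ that meets $\Sigma_\epsilon$ contains a point $q\in U\cap\Sigma_\epsilon$ with $\angle_q(\iota(U),C)\ge\alpha$. 4. ($\iota$ is $(\delta,\delta')$-tight on the boundary.) All members of $H\mathcal U$ have diameter at most $\delta$, and, with $\mathcal U_\Sigma=\{U\in\mathcal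 U : U\cap\Sigma_\epsilon\neq\emptyset\}$, the map $\iota$ sends the vertex set of every simplex of the nerve of $H\mathcal U_\Sigma$ to a set of diameter at most $\delta'$. -/

import Mathlib

open Set Filter Topology
open scoped Pointwise

namespace CATZero

section Geometry

variable {X : Type*} [MetricSpace X]

/-- `γ`, restricted to `[0, dist x y]`, is a geodesic segment from `x` to `y`
parametrised by arc length. -/
structure IsGeodesic (γ : ℝ → X) (x y : X) : Prop where
  start : γ 0 = x
  finish : γ (dist x y) = y
  isometric : ∀ s ∈ Icc (0 : ℝ) (dist x y), ∀ t ∈ Icc (0 : ℝ) (dist x y),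
    dist (γ s) (γ t) = |s - t|

/-- `X` is a CAT(0) space: it is geodesic, and geodesic triangles are not fatter than their
comparison triangles in the Euclidean plane. The comparison points `p'`, `q'` are the points
of the sides `[x', y']`, `[x', z']` that lie at distance `s`, `t` from `x'`. -/
structure IsCAT0 (X : Type*) [MetricSpace X] : Prop where
  geodesic : ∀ x y : X, ∃ γ : ℝ → X, IsGeodesic γ x y
  comparison : ∀ (x y z : X) (γ η : ℝ → X), IsGeodesic γ x y → IsGeodesic η x z →
    ∀ x' y' z' : EuclideanSpace ℝ (Fin 2),
      dist x' y' = dist x y → dist y' z' = dist y z → dist x' z' = dist x z →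
    ∀ s ∈ Icc (0 : ℝ) (dist x y), ∀ t ∈ Icc (0 : ℝ) (dist x z),
    ∀ p' q' : EuclideanSpace ℝ (Fin 2),
      dist x' p' = s → dist p' y' = dist x y - s →
      dist x' q' = t → dist q' z' = dist x z - t →
      dist (γ s) (η t) ≤ dist p' q'

/-- Geodesic convexity of a subset. -/
def IsGeodesicallyConvex (C : Set X) : Prop :=
  ∀ x ∈ C, ∀ y ∈ C, ∀ γ : ℝ → X, IsGeodesic γ x y → ∀ t ∈ Icc (0 : ℝ) (dist x y), γ t ∈ C

open Classical in
/-- A chosen geodesic from `x` to `y`; in a CAT(0) space its values on `[0, dist x y]` are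
uniquely determined. -/
noncomputable def geod (x y : X) : ℝ → X :=
  if h : ∃ γ : ℝ → X, IsGeodesic γ x y then h.choose else fun _ => x

/-- The Euclidean comparison angle at `o` of the triangle `o`, `p`, `q` (law of cosines). -/
noncomputable def comparisonAngle (o p q : X) : ℝ :=
  Real.arccos ((dist o p ^ 2 + dist o q ^ 2 - dist p q ^ 2) / (2 * dist o p * dist o q))

/-- The Alexandrov angle at `o` between the geodesics from `o` to `p` and from `o` to `q`
(for `p` and `q` different from `o`). -/
noncomputable def angle (o p q : X) : ℝ :=
  limsup (fun st : ℝ × ℝ => comparisonAngle o (geod o p st.1) (geod o q st.2))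
    (𝓝[>] (0 : ℝ) ×ˢ 𝓝[>] (0 : ℝ))

open Classical in
/-- The closest-point projection to `C`. -/
noncomputable def proj (C : Set X) (q : X) : X :=
  if h : ∃ c ∈ C, dist q c = Metric.infDist q C then h.choose else q

/-- The angle at `q` between the geodesic from `q` to `q'` and the geodesic from `q` to the
closest point of `C`. -/
noncomputable def angleTo (C : Set X) (q q' : X) : ℝ := angle q q' (proj C q)

/-- `A` is a connected component of the set `B`. -/
def IsComponentOf (A B : Set X) : Prop := ∃ x ∈ B, A = connectedComponentIn B x

/-- `Y` is a connected component, bounded by `S`, of the complement of `D`. -/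
def IsComplementComponent (D S Y : Set X) : Prop :=
  IsComponentOf Y Dᶜ ∧ (frontier Y ∩ S).Nonempty

/-- `b` is a `lam`-barycenter of `P` relative to `Q`. -/
def IsBarycenter (lam : ℝ) (P Q : Set X) (b : X) : Prop :=
  (∀ p ∈ P, dist b p ≤ lam * Metric.diam P) ∧
    ∀ q ∈ Q, dist b q ≤ Metric.diam (insert q P)

/-- The subspace `Z` has `lam`-barycenters up to diameter `Δ`. -/
def HasBarycenters (lam Δ : ℝ) (Z : Set X) : Prop :=
  ∀ P Q : Set X, P ⊆ Z → Q ⊆ Z → P.Finite → Q.Finite → P.Nonempty →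
    Metric.diam P ≤ Δ → Metric.diam (P ∪ Q) ≤ 2 * Δ →
    ∃ b ∈ Z, IsBarycenter lam P Q b

/-- The finite set `σ` of vertices spans a simplex of the nerve of `V`. -/
def IsNerveSimplex (V : Set (Set X)) (σ : Finset (Set X)) : Prop :=
  σ.Nonempty ∧ (σ : Set (Set X)) ⊆ V ∧ (⋂₀ (σ : Set (Set X))).Nonempty

end Geometry

section Action

variable {X : Type*} [MetricSpace X] (H : Type*) [Group H] [MulAction H X]

/-- The union `H K` of all translates of `K`. -/
def orbitSet (K : Set X) : Set X := ⋃ h : H, h • K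

/-- The collection `H 𝒰` of all translates of members of `𝒰`. -/
def orbitFamily (U : Set (Set X)) : Set (Set X) := {V | ∃ h : H, ∃ W ∈ U, V = h • W}

/-- The members of `U` that meet `S`. -/
def meeting (S : Set X) (U : Set (Set X)) : Set (Set X) := {W | W ∈ U ∧ (W ∩ S).Nonempty}

/-- The diameter of `Kout` relative to `H` and `K`. -/
noncomputable def relDiam (K Kout : Set X) : ℝ :=
  sSup {r | ∃ h : H, ((h • K) ∩ K).Nonempty ∧ r = Metric.diam ((h • Kout) ∪ Kout)}

/-- The pair `(δ, δ')` is small relative to `K`, `Kout` and `α`. Here `C` is the convex set,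
`Metric.cthickening ε C` its closed `ε`-neighbourhood, and `S` a component of the boundary of
that neighbourhood. -/
structure IsSmall (C : Set X) (ε : ℝ) (S K Kout : Set X) (α δ δ' : ℝ) : Prop where
  pos : 0 < δ
  pos' : 0 < δ'
  separated : ∀ h : H, (h • K) ∩ K = ∅ →
    2 * δ < sInf {r | ∃ p ∈ K, ∃ q ∈ h • K, r = dist p q}
  disjoint : Metric.cthickening δ' Kout ∩ Metric.cthickening ε C = ∅
  angle_le : ∀ q₁ ∈ Metric.cthickening δ K ∩ S, ∀ q₂ ∈ Metric.cthickening δ K ∩ S,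
    ∀ q₁' ∈ Metric.cthickening δ' Kout, ∀ q₂' ∈ Metric.cthickening δ' Kout,
      dist q₁ q₂ ≤ δ → dist q₁' q₂' ≤ δ' →
      |angleTo C q₁ q₁' - angleTo C q₂ q₂'| ≤ α / 2 - Real.pi / 4

/-- `U` is a finite cover of `K` by open sets of diameter at most `δ`. -/
structure IsSmallCover (K : Set X) (δ : ℝ) (U : Set (Set X)) : Prop where
  finite : U.Finite
  isOpen : ∀ W ∈ U, IsOpen W
  covers : K ⊆ ⋃₀ U
  ediam_le : ∀ W ∈ U, Metric.ediam W ≤ ENNReal.ofReal δ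

/-- The family `U` is `H`-fine: its members are disjoint from their nontrivial translates. -/
def IsFine (U : Set (Set X)) : Prop := ∀ W ∈ U, ∀ h : H, h ≠ 1 → W ∩ (h • W) = ∅

/-- `ι` is a `(U, α)`-push-off grid: an `H`-equivariant map from the vertices of the nerve of
`H U` (for an `H`-fine `U`) to `Y`, which pushes every member of `U` that meets `S` away from
`C` at an angle at least `α`. Only the values of `ι` on `orbitFamily H U` matter. -/
structure IsPushOffGrid (C S Y : Set X) (U : Set (Set X)) (α : ℝ) (ι : Set X → X) : Prop where
  fine : IsFine H U
  mem : ∀ V ∈ orbitFamily H U, ι V ∈ Y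
  equivariant : ∀ h : H, ∀ V ∈ orbitFamily H U, ι (h • V) = h • ι V
  angle_ge : ∀ W ∈ meeting S U, ∃ q ∈ W ∩ S, α ≤ angleTo C q (ι W)

/-- `ι` is `(δ, δ')`-tight on the boundary: the members of `H U` have diameter at most `δ`,
and `ι` sends the vertices of every simplex of the nerve of `H U_S`, where `U_S` consists of the
members of `U` that meet `S`, to a set of diameter at most `δ'`. -/
def IsTightOnBoundary (S : Set X) (U : Set (Set X)) (δ δ' : ℝ) (ι : Set X → X) : Prop :=
  (∀ V ∈ orbitFamily H U, Metric.ediam V ≤ ENNReal.ofReal δ) ∧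
    ∀ σ : Finset (Set X), IsNerveSimplex (orbitFamily H (meeting S U)) σ →
      Metric.diam (ι '' (σ : Set (Set X))) ≤ δ'

/-- The closed `ε`-neighbourhood of `C` has `lam`-barycenters up to `H`, with respect to the
component `S` of its boundary and the component `Y` of its complement. The set `Y'` is the
component, corresponding to `Y`, of the complement of the `(ε + δ')`-neighbourhood. -/
def HasBarycentersUpTo (C : Set X) (ε : ℝ) (S Y : Set X) (lam : ℝ) : Prop :=
  ∃ (K Kout : Set X) (α δ δ' : ℝ) (U : Set (Set X)),
    IsCompact K ∧ K ⊆ Metric.cthickening ε C ∧ orbitSet H K = Metric.cthickening ε C ∧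
    IsCompact Kout ∧ Kout ⊆ Y ∧
    Real.pi / 2 < α ∧
    IsSmall H C ε S K Kout α δ δ' ∧
    IsSmallCover K δ U ∧
    (∃ Z Y' : Set X,
      IsComponentOf Y' (Metric.cthickening (ε + δ') C)ᶜ ∧ (Y' ∩ Y).Nonempty ∧
      (∀ h : H, h • Z = Z) ∧
      orbitSet H Kout ⊆ Z ∧ Z ⊆ Y' ∧
      HasBarycenters lam (relDiam H K Kout) Z) ∧
    ∃ ι : Set X → X,
      IsPushOffGrid H C S Y U α ι ∧
      IsTightOnBoundary H S U δ δ' ι ∧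
      (∀ W ∈ U, ι W ∈ Kout) ∧ ∀ V ∈ orbitFamily H U, ι V ∈ orbitSet H Kout

end Action

end CATZero

/-! Write D for the closed ε-neighbourhood of C and F for its frontier. D is convex, hence
contractible, so it suffices to show that the inclusion of S into F is homotopic in F to a map that
factors through D. It is then nullhomotopic, and the tracks of the homotopy cannot leave the
component S (`contractibleSpace_of_nullhomotopic_inclusion`).

The push-off grid gives a map f from S to the complement of D: each point goes to an iterated
geodesic join of the grid points of the cover members containing it
(`IsStarFiniteCover.exists_continuous`). Tightness keeps f(q) within δ' of these grid points, so the
geodesic from q to f(q) starts at an obtuse angle to C and leaves D at once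
(`infDist_lt_of_angleTo`). Radial retraction R onto F turns these geodesics into a homotopy in F
from the inclusion to R ∘ f (`homotopic_retr_comp`).

It remains to extend f, up to homotopy outside D, to a map G on D. Over the interior of D, grid
points of overlapping members may be far apart, and their joins may enter D. Subdividing the nerve
with vertices at barycenters in Z multiplies these distances by λ < 1
(`IsStarFiniteCover.exists_subdivision`); after finitely many rounds they are at most δ', and joins
stay in δ'-balls around points of Z, which miss D. Over S all distances are at most δ' from the
outset, so each round changes the map on S only by a homotopy outside D (`exists_filling`). The
inclusion is thus homotopic to R ∘ G restricted to S. -/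

namespace CATZero

/-! ### Metric geometry of CAT(0) spaces -/

section CATZeroGeometry

variable {X : Type*} [MetricSpace X]

/-- Every Euclidean triangle inequality is realised by a triangle with a vertex at the origin. -/
theorem exists_comparison_triangle {a b c : ℝ} (ha : 0 ≤ a) (hb : 0 ≤ b) (hc : 0 ≤ c)
    (habc : a ≤ b + c) (hbac : b ≤ a + c) (hcab : c ≤ a + b) :
    ∃ y z : EuclideanSpace ℝ (Fin 2), ‖y‖ = a ∧ ‖z‖ = c ∧ dist y z = b := by
  rcases ha.eq_or_lt with rfl | ha'
  · have : b = c := by linarith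
    subst this
    refine ⟨0, !₂[b, 0], by simp, ?_, ?_⟩
    · simp [EuclideanSpace.norm_eq, Real.sqrt_sq hb]
    · simp [EuclideanSpace.norm_eq, Real.sqrt_sq hb]
  · set u := (a ^ 2 + c ^ 2 - b ^ 2) / (2 * a) with hu
    have hua : 2 * a * u = a ^ 2 + c ^ 2 - b ^ 2 := by rw [hu]; field_simp
    have huc : u ^ 2 ≤ c ^ 2 := by
      have h1 : u ≤ c := by
        have : 2 * a * u ≤ 2 * a * c := by nlinarith
        nlinarith
      have h2 : -c ≤ u := by
        have : 2 * a * (-c) ≤ 2 * a * u := by nlinarith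
        nlinarith
      nlinarith
    refine ⟨!₂[a, 0], !₂[u, √(c ^ 2 - u ^ 2)], ?_, ?_, ?_⟩
    · simp [EuclideanSpace.norm_eq, Real.sqrt_sq ha]
    · rw [EuclideanSpace.norm_eq]
      simp only [Real.norm_eq_abs, sq_abs, Fin.sum_univ_two]
      simp [Real.sq_sqrt (sub_nonneg.2 huc), Real.sqrt_sq hc]
    · rw [EuclideanSpace.dist_eq]
      simp only [Real.dist_eq, sq_abs, Fin.sum_univ_two]
      simp only [Matrix.cons_val_zero, Matrix.cons_val_one, zero_sub, even_two,
        Even.neg_pow, Real.sq_sqrt (sub_nonneg.2 huc)]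
      rw [← Real.sqrt_sq hb]
      congr 1
      nlinarith

/-- The comparison axiom with the Euclidean distance expanded by the law of cosines, so that
comparison triangles are not needed afterwards. -/
theorem dist_sq_geodesics_le (hX : IsCAT0 X) {x y z : X} {γ η : ℝ → X} (hγ : IsGeodesic γ x y)
    (hη : IsGeodesic η x z) {s t : ℝ} (hs : s ∈ Icc (0 : ℝ) 1) (ht : t ∈ Icc (0 : ℝ) 1) :
    dist (γ (s * dist x y)) (η (t * dist x z)) ^ 2 ≤
      s ^ 2 * dist x y ^ 2 + t ^ 2 * dist x z ^ 2
        - s * t * (dist x y ^ 2 + dist x z ^ 2 - dist y z ^ 2) := by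
  obtain ⟨y', z', hy, hz, hyz⟩ := exists_comparison_triangle (a := dist x y) (b := dist y z)
    (c := dist x z) dist_nonneg dist_nonneg dist_nonneg
    (by have := dist_triangle_right x y z; linarith) (by have := dist_triangle_left y z x; linarith)
    (dist_triangle _ _ _)
  have key := hX.comparison x y z γ η hγ hη 0 y' z' (by simpa using hy) hyz (by simpa using hz)
    (s * dist x y) ⟨mul_nonneg hs.1 dist_nonneg, mul_le_of_le_one_left dist_nonneg hs.2⟩
    (t * dist x z) ⟨mul_nonneg ht.1 dist_nonneg, mul_le_of_le_one_left dist_nonneg ht.2⟩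
    (s • y') (t • z')
    (by simp [norm_smul, hy, abs_of_nonneg hs.1])
    (by
      have : s • y' - y' = (s - 1) • y' := by module
      rw [dist_eq_norm, this, norm_smul, hy, Real.norm_eq_abs, abs_of_nonpos (by linarith [hs.2])]
      ring)
    (by simp [norm_smul, hz, abs_of_nonneg ht.1])
    (by
      have : t • z' - z' = (t - 1) • z' := by module
      rw [dist_eq_norm, this, norm_smul, hz, Real.norm_eq_abs, abs_of_nonpos (by linarith [ht.2])]
      ring)
  have h1 : dist (s • y') (t • z') ^ 2 = s ^ 2 * dist x y ^ 2 + t ^ 2 * dist x z ^ 2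
      - s * t * (dist x y ^ 2 + dist x z ^ 2 - dist y z ^ 2) := by
    have h2 := norm_sub_sq_real y' z'
    rw [← dist_eq_norm, hyz, hy, hz] at h2
    have h3 := norm_sub_sq_real (s • y') (t • z')
    rw [← dist_eq_norm, norm_smul, norm_smul, hy, hz, Real.norm_eq_abs, Real.norm_eq_abs,
      abs_of_nonneg hs.1, abs_of_nonneg ht.1, real_inner_smul_left, real_inner_smul_right] at h3
    rw [h3]
    linear_combination (-(s * t)) * h2
  rw [← h1]
  gcongr

theorem isGeodesic_geod (hX : IsCAT0 X) (x y : X) : IsGeodesic (geod x y) x y := by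
  have h := hX.geodesic x y
  rw [geod, dif_pos h]
  exact h.choose_spec

/-- The point of the geodesic segment from `x` to `y` that divides it in the ratio
`t : (1 - t)`. -/
noncomputable def seg (x y : X) (t : ℝ) : X := geod x y (t * dist x y)

theorem seg_zero (hX : IsCAT0 X) (x y : X) : seg x y 0 = x := by
  simpa [seg] using (isGeodesic_geod hX x y).start

theorem seg_one (hX : IsCAT0 X) (x y : X) : seg x y 1 = y := by
  simpa [seg] using (isGeodesic_geod hX x y).finish

theorem mul_mem_Icc {d t : ℝ} (hd : 0 ≤ d) (ht : t ∈ Icc (0 : ℝ) 1) : t * d ∈ Icc 0 d :=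
  ⟨mul_nonneg ht.1 hd, mul_le_of_le_one_left hd ht.2⟩

theorem dist_seg_seg (hX : IsCAT0 X) (x y : X) {s t : ℝ} (hs : s ∈ Icc (0 : ℝ) 1)
    (ht : t ∈ Icc (0 : ℝ) 1) : dist (seg x y s) (seg x y t) = |s - t| * dist x y := by
  rw [seg, seg, (isGeodesic_geod hX x y).isometric _ (mul_mem_Icc dist_nonneg hs) _
    (mul_mem_Icc dist_nonneg ht), ← sub_mul, abs_mul, abs_of_nonneg (dist_nonneg (x := x))]

theorem dist_left_seg (hX : IsCAT0 X) (x y : X) {t : ℝ} (ht : t ∈ Icc (0 : ℝ) 1) :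
    dist x (seg x y t) = t * dist x y := by
  have := dist_seg_seg hX x y (s := 0) (by simp) ht
  rwa [seg_zero hX, zero_sub, abs_neg, abs_of_nonneg ht.1] at this

theorem dist_seg_right (hX : IsCAT0 X) (x y : X) {t : ℝ} (ht : t ∈ Icc (0 : ℝ) 1) :
    dist (seg x y t) y = (1 - t) * dist x y := by
  have := dist_seg_seg hX x y ht (t := 1) (by simp)
  rwa [seg_one hX, abs_sub_comm, abs_of_nonneg (by linarith [ht.2])] at this

/-- The Bruhat–Tits inequality. -/
theorem dist_sq_seg_le (hX : IsCAT0 X) (x y z : X) {t : ℝ} (ht : t ∈ Icc (0 : ℝ) 1) :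
    dist z (seg x y t) ^ 2 ≤
      (1 - t) * dist z x ^ 2 + t * dist z y ^ 2 - t * (1 - t) * dist x y ^ 2 := by
  have h := dist_sq_geodesics_le hX (isGeodesic_geod hX x y) (isGeodesic_geod hX x z) ht
    (t := 1) (by simp)
  rw [one_mul, (isGeodesic_geod hX x z).finish, dist_comm _ z] at h
  rw [dist_comm z x, dist_comm z y, seg]
  linarith

/-- The right-hand side of the Bruhat–Tits inequality vanishes under these hypotheses; this is
uniqueness of geodesics. -/
theorem eq_seg (hX : IsCAT0 X) {x y z : X} {t : ℝ} (ht : t ∈ Icc (0 : ℝ) 1)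
    (hx : dist z x = t * dist x y) (hy : dist z y = (1 - t) * dist x y) : z = seg x y t := by
  have h := dist_sq_seg_le hX x y z ht
  rw [hx, hy] at h
  have : dist z (seg x y t) ^ 2 ≤ 0 := by nlinarith
  exact dist_eq_zero.1 (pow_eq_zero_iff two_ne_zero |>.1 (le_antisymm this (sq_nonneg _)))

theorem one_sub_mem_Icc {t : ℝ} (ht : t ∈ Icc (0 : ℝ) 1) : 1 - t ∈ Icc (0 : ℝ) 1 :=
  ⟨by linarith [ht.2], by linarith [ht.1]⟩

theorem seg_comm (hX : IsCAT0 X) (x y : X) {t : ℝ} (ht : t ∈ Icc (0 : ℝ) 1) :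
    seg x y t = seg y x (1 - t) := by
  refine eq_seg hX (one_sub_mem_Icc ht) ?_ ?_
  · rw [dist_seg_right hX x y ht, dist_comm x y]
  · rw [dist_comm, dist_left_seg hX x y ht, dist_comm x y]; ring

theorem dist_seg_seg_right_le (hX : IsCAT0 X) (x y y' : X) {t : ℝ} (ht : t ∈ Icc (0 : ℝ) 1) :
    dist (seg x y t) (seg x y' t) ≤ t * dist y y' := by
  have h := dist_sq_geodesics_le hX (isGeodesic_geod hX x y) (isGeodesic_geod hX x y') ht ht
  refine abs_le_of_sq_le_sq' ?_ (mul_nonneg ht.1 dist_nonneg) |>.2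
  rw [seg, seg]
  linarith

theorem dist_seg_seg_le (hX : IsCAT0 X) (x x' y y' : X) {t : ℝ} (ht : t ∈ Icc (0 : ℝ) 1) :
    dist (seg x y t) (seg x' y' t) ≤ (1 - t) * dist x x' + t * dist y y' := by
  have h1 := dist_seg_seg_right_le hX x y y' ht
  have h2 := dist_seg_seg_right_le hX y' x x' (one_sub_mem_Icc ht)
  rw [← seg_comm hX _ _ ht, ← seg_comm hX _ _ ht] at h2
  linarith [dist_triangle (seg x y t) (seg x y' t) (seg x' y' t)]

theorem seg_self (hX : IsCAT0 X) (x : X) {t : ℝ} (ht : t ∈ Icc (0 : ℝ) 1) : seg x x t = x := by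
  have := dist_left_seg hX x x ht
  rw [dist_self, mul_zero] at this
  exact (dist_eq_zero.1 this).symm

/-- A set that contains the geodesic segments between its points. -/
def SegConvex (B : Set X) : Prop :=
  ∀ x ∈ B, ∀ y ∈ B, ∀ t ∈ Icc (0 : ℝ) 1, seg x y t ∈ B

theorem segConvex_closedBall (hX : IsCAT0 X) (z : X) (r : ℝ) :
    SegConvex (Metric.closedBall z r) := by
  intro x hx y hy t ht
  rw [Metric.mem_closedBall] at *
  have h := dist_seg_seg_le hX x z y z ht
  rw [seg_self hX z ht] at h
  nlinarith [ht.1, ht.2]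

theorem IsGeodesicallyConvex.segConvex (hX : IsCAT0 X) {C : Set X} (hC : IsGeodesicallyConvex C) :
    SegConvex C :=
  fun x hx y hy _ ht => hC x hx y hy _ (isGeodesic_geod hX x y) _ (mul_mem_Icc dist_nonneg ht)

theorem continuousAt_seg (hX : IsCAT0 X) {T : Type*} [TopologicalSpace T] {f g : T → X} {w : T → ℝ}
    {t₀ : T} (hf : ContinuousAt f t₀) (hg : ContinuousAt g t₀) (hw : ContinuousAt w t₀)
    (hmem : ∀ t, w t ∈ Icc (0 : ℝ) 1) : ContinuousAt (fun t => seg (f t) (g t) (w t)) t₀ := by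
  have hlim : Tendsto (fun t => dist (f t) (f t₀) + dist (g t) (g t₀)
      + |w t - w t₀| * dist (f t₀) (g t₀)) (𝓝 t₀) (𝓝 0) := by
    have : ContinuousAt (fun t => dist (f t) (f t₀) + dist (g t) (g t₀)
      + |w t - w t₀| * dist (f t₀) (g t₀)) t₀ := by fun_prop
    simpa [ContinuousAt] using this
  refine tendsto_iff_dist_tendsto_zero.2 (squeeze_zero (fun _ => dist_nonneg) (fun t => ?_) hlim)
  have h1 := dist_seg_seg_le hX (f t) (f t₀) (g t) (g t₀) (hmem t)
  have h2 := dist_seg_seg hX (f t₀) (g t₀) (hmem t) (hmem t₀)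
  have h3 := dist_triangle (seg (f t) (g t) (w t)) (seg (f t₀) (g t₀) (w t))
    (seg (f t₀) (g t₀) (w t₀))
  nlinarith [(hmem t).1, (hmem t).2, dist_nonneg (x := f t) (y := f t₀),
    dist_nonneg (x := g t) (y := g t₀)]

theorem continuous_seg (hX : IsCAT0 X) {T : Type*} [TopologicalSpace T] {f g : T → X} {w : T → ℝ}
    (hf : Continuous f) (hg : Continuous g) (hw : Continuous w)
    (hmem : ∀ t, w t ∈ Icc (0 : ℝ) 1) : Continuous (fun t => seg (f t) (g t) (w t)) :=
  continuous_iff_continuousAt.2 fun _ =>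
    continuousAt_seg hX hf.continuousAt hg.continuousAt hw.continuousAt hmem

/-- Quadrilateral inequality: the squared diagonals are at most the squared sides in sum. Compare y
and p with the midpoint of q and r. -/
theorem dist_sq_add_dist_sq_le (hX : IsCAT0 X) (p q y r : X) :
    dist q r ^ 2 + dist y p ^ 2 ≤
      dist q p ^ 2 + dist y r ^ 2 + dist q y ^ 2 + dist p r ^ 2 := by
  have ht : (1 / 2 : ℝ) ∈ Icc (0 : ℝ) 1 := by constructor <;> norm_num
  have h1 := dist_sq_seg_le hX q r y ht
  have h2 := dist_sq_seg_le hX q r p ht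
  have h3 := dist_triangle_right y p (seg q r (1 / 2))
  have h4 : dist y p ^ 2 ≤ 2 * dist y (seg q r (1 / 2)) ^ 2 + 2 * dist p (seg q r (1 / 2)) ^ 2 := by
    nlinarith [sq_nonneg (dist y (seg q r (1 / 2)) - dist p (seg q r (1 / 2))),
      dist_nonneg (x := y) (y := p)]
  rw [dist_comm y q] at h1
  rw [dist_comm p q] at h2
  nlinarith

/-- Comparison angles shrink with the sides, so each of them bounds the limit superior that defines
the Alexandrov angle. -/
theorem angle_le_comparisonAngle (hX : IsCAT0 X) {o x p : X} {s : ℝ} (hs : s ∈ Ioc 0 (dist o x))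
    (hp : o ≠ p) : angle o x p ≤ comparisonAngle o (geod o x s) p := by
  have hg := isGeodesic_geod hX o x
  have hd0 : dist o (geod o x s) = s := by
    have := hg.isometric 0 ⟨le_rfl, dist_nonneg⟩ s ⟨hs.1.le, hs.2⟩
    rwa [hg.start, zero_sub, abs_neg, abs_of_pos hs.1] at this
  have hg' : IsGeodesic (geod o x) o (geod o x s) := by
    refine ⟨hg.start, by rw [hd0], fun a ha b hb => ?_⟩
    rw [hd0] at ha hb
    exact hg.isometric a ⟨ha.1, ha.2.trans hs.2⟩ b ⟨hb.1, hb.2.trans hs.2⟩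
  have hη := isGeodesic_geod hX o p
  have hop : 0 < dist o p := dist_pos.2 hp
  refine limsup_le_of_le ?_ ?_
  · exact IsCoboundedUnder.of_frequently_ge (a := 0)
      (Eventually.of_forall fun _ => Real.arccos_nonneg _).frequently
  · have e1 : ∀ᶠ a in 𝓝[>] (0 : ℝ), a ∈ Ioc 0 s := Ioc_mem_nhdsGT hs.1
    have e2 : ∀ᶠ a in 𝓝[>] (0 : ℝ), a ∈ Ioc 0 (dist o p) := Ioc_mem_nhdsGT hop
    filter_upwards [e1.prod_mk e2] with ⟨a, b⟩ ⟨ha, hb⟩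
    simp only at ha hb ⊢
    have key := dist_sq_geodesics_le hX hg' hη (s := a / s) (t := b / dist o p)
      ⟨by have := ha.1; have := hs.1; positivity, (div_le_one hs.1).2 ha.2⟩
      ⟨by have := hb.1; positivity, (div_le_one hop).2 hb.2⟩
    rw [hd0, div_mul_cancel₀ _ hs.1.ne', div_mul_cancel₀ _ hop.ne'] at key
    have hda : dist o (geod o x a) = a := by
      have := hg.isometric 0 ⟨le_rfl, dist_nonneg⟩ a ⟨ha.1.le, ha.2.trans hs.2⟩
      rwa [hg.start, zero_sub, abs_neg, abs_of_pos ha.1] at this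
    have hdb : dist o (geod o p b) = b := by
      have := hη.isometric 0 ⟨le_rfl, dist_nonneg⟩ b ⟨hb.1.le, hb.2⟩
      rwa [hη.start, zero_sub, abs_neg, abs_of_pos hb.1] at this
    rw [comparisonAngle, comparisonAngle, hda, hdb, hd0]
    apply Real.arccos_le_arccos
    have hs0 := hs.1
    have ha0 := ha.1
    have hb0 := hb.1
    rw [div_le_div_iff₀ (by positivity) (by positivity)]
    have hk : (a / s) ^ 2 * s ^ 2 + (b / dist o p) ^ 2 * dist o p ^ 2 = a ^ 2 + b ^ 2 := by
      field_simp
    rw [hk] at key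
    have hk2 : (a / s * (b / dist o p) * (s ^ 2 + dist o p ^ 2 - dist (geod o x s) p ^ 2))
        * (2 * s * dist o p) =
        (s ^ 2 + dist o p ^ 2 - dist (geod o x s) p ^ 2) * (2 * a * b) := by
      field_simp
    rw [← hk2]
    apply mul_le_mul_of_nonneg_right _ (by positivity)
    linarith

end CATZeroGeometry

/-! ### Projection to a convex set and radial retraction -/

section Projection

variable {X : Type*} [MetricSpace X] {C : Set X}

/-- A minimizing sequence is Cauchy: midpoints stay in C, so Bruhat–Tits bounds the distance of two
almost closest points. -/
theorem exists_dist_eq_infDist (hX : IsCAT0 X) (hC : SegConvex C) (hcomp : IsComplete C)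
    (hne : C.Nonempty) (q : X) : ∃ c ∈ C, dist q c = Metric.infDist q C := by
  set d := Metric.infDist q C with hd
  have hd0 : 0 ≤ d := Metric.infDist_nonneg
  have hex : ∀ n : ℕ, ∃ c ∈ C, dist q c < d + 1 / ((n : ℝ) + 1) := fun n =>
    (Metric.infDist_lt_iff hne).1 (lt_add_of_pos_right _ Nat.one_div_pos_of_nat)
  choose c hcC hc using hex
  have hlim : Tendsto (fun n : ℕ => d + 1 / ((n : ℝ) + 1)) atTop (𝓝 d) := by
    simpa using tendsto_one_div_add_atTop_nhds_zero_nat.const_add d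
  have hcau : CauchySeq c := by
    refine cauchySeq_of_le_tendsto_0
      (fun N : ℕ => √(4 * ((d + 1 / ((N : ℝ) + 1)) ^ 2 - d ^ 2))) (fun n m N hn hm => ?_) ?_
    · apply Real.le_sqrt_of_sq_le
      have hmid := dist_sq_seg_le hX (c n) (c m) q (t := 1 / 2) (by constructor <;> norm_num)
      have hdm : d ≤ dist q (seg (c n) (c m) (1 / 2)) := Metric.infDist_le_dist_of_mem
        (hC _ (hcC n) _ (hcC m) _ (by constructor <;> norm_num))
      have hb : ∀ k : ℕ, N ≤ k → dist q (c k) ^ 2 ≤ (d + 1 / ((N : ℝ) + 1)) ^ 2 := by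
        intro k hk
        have : dist q (c k) ≤ d + 1 / ((N : ℝ) + 1) :=
          (hc k).le.trans (by gcongr)
        gcongr
      have h1 := hb n hn
      have h2 := hb m hm
      have h3 : d ^ 2 ≤ dist q (seg (c n) (c m) (1 / 2)) ^ 2 := by gcongr
      nlinarith
    · have : Tendsto (fun N : ℕ => √(4 * ((d + 1 / ((N : ℝ) + 1)) ^ 2 - d ^ 2))) atTop
          (𝓝 (√(4 * (d ^ 2 - d ^ 2)))) :=
        (((hlim.pow 2).sub_const _).const_mul 4).sqrt
      simpa using this
  obtain ⟨p, hpC, hp⟩ := cauchySeq_tendsto_of_isComplete hcomp hcC hcau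
  refine ⟨p, hpC, le_antisymm ?_ (Metric.infDist_le_dist_of_mem hpC)⟩
  exact le_of_tendsto_of_tendsto (tendsto_const_nhds.dist hp) hlim
    (Eventually.of_forall fun n => (hc n).le)

/-- A set to which every point has a closest-point projection. -/
def HasProj (C : Set X) : Prop := ∀ q, ∃ c ∈ C, dist q c = Metric.infDist q C

theorem HasProj.proj_mem (hP : HasProj C) (q : X) : proj C q ∈ C := by
  rw [proj, dif_pos (hP q)]; exact (hP q).choose_spec.1

theorem HasProj.dist_proj (hP : HasProj C) (q : X) : dist q (proj C q) = Metric.infDist q C := by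
  rw [proj, dif_pos (hP q)]; exact (hP q).choose_spec.2

/-- The angle at the projection is at least π/2. Apply Bruhat–Tits to points of C near the
projection on the way to c, divide by t and let t tend to 0. -/
theorem dist_sq_proj_add_le (hX : IsCAT0 X) (hC : SegConvex C) (hP : HasProj C) (q : X) {c : X}
    (hc : c ∈ C) : dist q (proj C q) ^ 2 + dist (proj C q) c ^ 2 ≤ dist q c ^ 2 := by
  have hlim : Tendsto (fun t : ℝ => dist q (proj C q) ^ 2 + (1 - t) * dist (proj C q) c ^ 2)
      (𝓝[>] 0) (𝓝 (dist q (proj C q) ^ 2 + (1 - 0) * dist (proj C q) c ^ 2)) := by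
    have : Continuous (fun t : ℝ => dist q (proj C q) ^ 2 + (1 - t) * dist (proj C q) c ^ 2) := by
      fun_prop
    exact (this.tendsto 0).mono_left nhdsWithin_le_nhds
  rw [sub_zero, one_mul] at hlim
  refine le_of_tendsto hlim ?_
  filter_upwards [Ioc_mem_nhdsGT (zero_lt_one (α := ℝ))] with t ht
  have ht' : t ∈ Icc (0 : ℝ) 1 := ⟨ht.1.le, ht.2⟩
  have h1 := dist_sq_seg_le hX (proj C q) c q ht'
  have h2 : dist q (proj C q) ≤ dist q (seg (proj C q) c t) := by
    rw [hP.dist_proj]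
    exact Metric.infDist_le_dist_of_mem (hC _ (hP.proj_mem q) _ hc _ ht')
  have h3 : dist q (proj C q) ^ 2 ≤ dist q (seg (proj C q) c t) ^ 2 := by gcongr
  have h4 : t * (dist q (proj C q) ^ 2 + (1 - t) * dist (proj C q) c ^ 2) ≤ t * dist q c ^ 2 := by
    nlinarith
  exact le_of_mul_le_mul_left h4 ht.1

/-- Add the two right-angle inequalities to the quadrilateral inequality. -/
theorem dist_proj_proj_le (hX : IsCAT0 X) (hC : SegConvex C) (hP : HasProj C) (q y : X) :
    dist (proj C q) (proj C y) ≤ dist q y := by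
  have h1 := dist_sq_proj_add_le hX hC hP q (hP.proj_mem y)
  have h2 := dist_sq_proj_add_le hX hC hP y (hP.proj_mem q)
  have h3 := dist_sq_add_dist_sq_le hX (proj C q) q y (proj C y)
  rw [dist_comm (proj C y)] at h2
  exact abs_le_of_sq_le_sq' (by linarith) dist_nonneg |>.2

theorem infDist_seg_le (hX : IsCAT0 X) (hC : SegConvex C) (hP : HasProj C) (x y : X) {t : ℝ}
    (ht : t ∈ Icc (0 : ℝ) 1) : Metric.infDist (seg x y t) C ≤
      (1 - t) * Metric.infDist x C + t * Metric.infDist y C := by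
  rw [← hP.dist_proj x, ← hP.dist_proj y]
  exact (Metric.infDist_le_dist_of_mem
    (hC _ (hP.proj_mem x) _ (hP.proj_mem y) _ ht)).trans (dist_seg_seg_le hX _ _ _ _ ht)

/-- The error term is quadratic in the distance from q to y; hence the comparison angle at q has
cosine at least a quantity tending to 0, which is how obtuse angles are excluded below. -/
theorem dist_sq_proj_le (hX : IsCAT0 X) (hC : SegConvex C) (hP : HasProj C) {q y : X}
    (hy : Metric.infDist y C ≤ Metric.infDist q C) :
    dist y (proj C q) ^ 2 ≤ Metric.infDist q C ^ 2 + 2 * dist q y ^ 2 := by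
  have h1 := dist_sq_add_dist_sq_le hX (proj C q) q y (proj C y)
  have h2 : dist (proj C q) (proj C y) ^ 2 ≤ dist q y ^ 2 := by
    gcongr; exact dist_proj_proj_le hX hC hP q y
  have h3 : Metric.infDist q C ^ 2 ≤ dist q (proj C y) ^ 2 := by
    gcongr
    · exact Metric.infDist_nonneg
    · exact Metric.infDist_le_dist_of_mem (hP.proj_mem y)
  have h4 : dist y (proj C y) ^ 2 ≤ Metric.infDist q C ^ 2 := by
    rw [hP.dist_proj]; gcongr; exact Metric.infDist_nonneg
  rw [hP.dist_proj q] at h1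
  linarith

/-- A geodesic that leaves `q` at an obtuse angle to `C` moves away from `C`. -/
theorem infDist_lt_of_angleTo (hX : IsCAT0 X) (hC : SegConvex C) (hP : HasProj C) {q x y : X}
    (hq : 0 < Metric.infDist q C) (hang : Real.pi / 2 < angleTo C q x)
    (hqy : y ≠ q) (hbtw : dist q y + dist y x = dist q x) :
    Metric.infDist q C < Metric.infDist y C := by
  by_contra! hle
  refine absurd hang (not_lt.2 ?_)
  have hqp : q ≠ proj C q := by
    intro h
    have := hP.dist_proj q
    rw [← h, dist_self] at this
    linarith
  have hdy : 0 < dist q y := dist_pos.2 hqy.symm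
  have hdx : 0 < dist q x := by linarith [dist_nonneg (x := y) (y := x)]
  have hyx : dist q y ≤ dist q x := by linarith [dist_nonneg (x := y) (y := x)]
  have hyseg : y = seg q x (dist q y / dist q x) := by
    refine eq_seg hX ⟨by positivity, (div_le_one hdx).2 hyx⟩ ?_ ?_
    · rw [div_mul_cancel₀ _ hdx.ne', dist_comm]
    · rw [sub_mul, div_mul_cancel₀ _ hdx.ne']; linarith
  -- The comparison angle at parameter s will be at most the arccosine of -s / (2 d(q, C)), which
  -- tends to π/2 as s tends to 0.
  have hlim : Tendsto (fun s : ℝ => Real.arccos (-s / (2 * Metric.infDist q C))) (𝓝[>] 0)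
      (𝓝 (Real.arccos (-0 / (2 * Metric.infDist q C)))) := by
    have : Continuous (fun s : ℝ => Real.arccos (-s / (2 * Metric.infDist q C))) :=
      Real.continuous_arccos.comp (by fun_prop)
    exact (this.tendsto 0).mono_left nhdsWithin_le_nhds
  rw [neg_zero, zero_div, Real.arccos_zero] at hlim
  refine ge_of_tendsto hlim ?_
  filter_upwards [Ioc_mem_nhdsGT hdy] with s hs
  refine (angle_le_comparisonAngle hX ⟨hs.1, hs.2.trans hyx⟩ hqp).trans ?_
  have hgs : geod q x s = seg q x (s / dist q x) := by rw [seg, div_mul_cancel₀ _ hdx.ne']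
  have hst : s / dist q x ∈ Icc (0 : ℝ) 1 :=
    ⟨div_nonneg hs.1.le hdx.le, (div_le_one hdx).2 (hs.2.trans hyx)⟩
  have hds : dist q (geod q x s) = s := by
    rw [hgs, dist_left_seg hX _ _ hst, div_mul_cancel₀ _ hdx.ne']
  have hss : geod q x s = seg q y (s / dist q y) := by
    have h1 : s / dist q y ∈ Icc (0 : ℝ) 1 := ⟨div_nonneg hs.1.le hdy.le, (div_le_one hdy).2 hs.2⟩
    refine eq_seg hX h1 ?_ ?_
    · rw [dist_comm, hds, div_mul_cancel₀ _ hdy.ne']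
    · rw [sub_mul, one_mul, div_mul_cancel₀ _ hdy.ne', hgs]
      nth_rw 1 [hyseg]
      rw [dist_seg_seg hX q x hst ⟨by positivity, (div_le_one hdx).2 hyx⟩, ← sub_div, abs_div,
        abs_of_pos hdx, div_mul_cancel₀ _ hdx.ne', abs_of_nonpos (by linarith [hs.2])]
      ring
  -- Convexity of the distance to C: if y is no farther than q, neither is any point between them.
  have hinf : Metric.infDist (geod q x s) C ≤ Metric.infDist q C := by
    have h1 : s / dist q y ∈ Icc (0 : ℝ) 1 := ⟨div_nonneg hs.1.le hdy.le, (div_le_one hdy).2 hs.2⟩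
    have := infDist_seg_le hX hC hP q y h1
    rw [hss]
    nlinarith [h1.1, h1.2]
  have hsq := dist_sq_proj_le hX hC hP hinf
  rw [hds] at hsq
  rw [comparisonAngle, hds, hP.dist_proj]
  apply Real.arccos_le_arccos
  have hs0 := hs.1
  rw [div_le_div_iff₀ (by positivity) (by positivity)]
  have : 0 ≤ (2 * Metric.infDist q C) *
      (2 * s ^ 2 + Metric.infDist q C ^ 2 - dist (geod q x s) (proj C q) ^ 2) := by
    apply mul_nonneg (by positivity); linarith
  nlinarith

theorem mem_cthickening_iff (hne : C.Nonempty) {ε : ℝ} (hε : 0 ≤ ε) {x : X} :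
    x ∈ Metric.cthickening ε C ↔ Metric.infDist x C ≤ ε := by
  rw [Metric.mem_cthickening_iff, Metric.infDist,
    ENNReal.le_ofReal_iff_toReal_le (Metric.infEDist_ne_top hne) hε]

theorem infDist_eq_of_mem_frontier (hne : C.Nonempty) {ε : ℝ} (hε : 0 ≤ ε) {x : X}
    (hx : x ∈ frontier (Metric.cthickening ε C)) : Metric.infDist x C = ε := by
  have h1 : x ∈ Metric.cthickening ε C :=
    Metric.isClosed_cthickening.frontier_subset hx
  rw [mem_cthickening_iff hne hε] at h1
  refine h1.antisymm (not_lt.1 fun hlt => hx.2 ?_)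
  refine mem_interior.2 ⟨{y | Metric.infDist y C < ε}, fun y hy => ?_,
    isOpen_lt (Metric.continuous_infDist_pt C) continuous_const, hlt⟩
  exact (mem_cthickening_iff hne hε).2 (le_of_lt hy)

/-- The retraction of the complement of the open `ε`-neighbourhood of `C` along the geodesics
to `C`. -/
noncomputable def retr (C : Set X) (ε : ℝ) (x : X) : X :=
  seg (proj C x) x (ε / Metric.infDist x C)

theorem retr_eq_self (hX : IsCAT0 X) {ε : ℝ} (hε : 0 < ε) {x : X} (hx : Metric.infDist x C = ε) :
    retr C ε x = x := by
  rw [retr, hx, div_self hε.ne', seg_one hX]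

theorem infDist_seg_proj (hX : IsCAT0 X) (hP : HasProj C) (x : X) {t : ℝ}
    (ht : t ∈ Icc (0 : ℝ) 1) : Metric.infDist (seg (proj C x) x t) C = t * Metric.infDist x C := by
  apply le_antisymm
  · refine (Metric.infDist_le_dist_of_mem (hP.proj_mem x)).trans ?_
    rw [dist_comm, dist_left_seg hX _ _ ht, dist_comm, hP.dist_proj]
  · have h1 := Metric.infDist_le_infDist_add_dist (s := C) (x := x) (y := seg (proj C x) x t)
    rw [dist_comm x, dist_seg_right hX _ _ ht, dist_comm _ x, hP.dist_proj] at h1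
    linarith

/-- The distance to C grows linearly along the geodesic from the projection to x, so points just
beyond the retract lie outside the neighbourhood. -/
theorem retr_mem_frontier (hX : IsCAT0 X) (hP : HasProj C) (hne : C.Nonempty) {ε : ℝ} (hε : 0 < ε)
    {x : X} (hx : ε < Metric.infDist x C) : retr C ε x ∈ frontier (Metric.cthickening ε C) := by
  have hd : 0 < Metric.infDist x C := hε.trans hx
  have ht : ε / Metric.infDist x C < 1 := (div_lt_one hd).2 hx
  have ht0 : 0 < ε / Metric.infDist x C := by positivity
  rw [frontier_eq_closure_inter_closure]
  constructor
  · apply subset_closure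
    rw [mem_cthickening_iff hne hε.le, retr, infDist_seg_proj hX hP x ⟨ht0.le, ht.le⟩,
      div_mul_cancel₀ _ hd.ne']
  · have hlim : Tendsto (fun t : ℝ => seg (proj C x) x (max 0 (min t 1)))
        (𝓝[>] (ε / Metric.infDist x C))
        (𝓝 (seg (proj C x) x (max 0 (min (ε / Metric.infDist x C) 1)))) := by
      have : Continuous (fun t : ℝ => seg (proj C x) x (max 0 (min t 1))) :=
        continuous_seg hX continuous_const continuous_const (by fun_prop)
          fun t => ⟨le_max_left _ _, max_le zero_le_one (min_le_right _ _)⟩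
      exact (this.tendsto _).mono_left nhdsWithin_le_nhds
    rw [min_eq_left ht.le, max_eq_right ht0.le] at hlim
    refine mem_closure_of_tendsto hlim ?_
    filter_upwards [Ioc_mem_nhdsGT ht] with t h
    have h0 : 0 ≤ t := ht0.le.trans h.1.le
    rw [min_eq_left h.2, max_eq_right h0, mem_compl_iff, mem_cthickening_iff hne hε.le,
      infDist_seg_proj hX hP x ⟨h0, h.2⟩, not_le]
    exact (div_lt_iff₀ hd).1 h.1

theorem continuous_proj (hX : IsCAT0 X) (hC : SegConvex C) (hP : HasProj C) :
    Continuous (proj C) :=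
  (LipschitzWith.of_dist_le_mul (K := 1) fun x y => by
    simpa using dist_proj_proj_le hX hC hP x y).continuous

theorem continuous_retr_comp (hX : IsCAT0 X) (hC : SegConvex C) (hP : HasProj C) {ε : ℝ}
    (hε : 0 < ε) {T : Type*} [TopologicalSpace T] {f : T → X} (hf : Continuous f)
    (h : ∀ t, ε ≤ Metric.infDist (f t) C) : Continuous fun t => retr C ε (f t) := by
  have hpos : ∀ t, 0 < Metric.infDist (f t) C := fun t => hε.trans_le (h t)
  refine continuous_seg hX ((continuous_proj hX hC hP).comp hf) hf ?_ fun t =>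
    ⟨(div_pos hε (hpos t)).le, (div_le_one (hpos t)).2 (h t)⟩
  exact continuous_const.div ((Metric.continuous_infDist_pt C).comp hf) fun t => (hpos t).ne'

end Projection

/-! ### Completeness of cocompact orbits -/

section Completeness

variable {X : Type*} [MetricSpace X] {H : Type*} [Group H] [MulAction H X]
  [ProperlyDiscontinuousSMul H X]

/-- If nontrivial elements moved k arbitrarily little, the orbit points with their limit k would
form a compact set. Properness leaves finitely many such elements, and freeness makes their least
displacement positive. -/
theorem exists_ball_forall_eq_one (hfree : ∀ (h : H) (x : X), h • x = x → h = 1) (k : X) :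
    ∃ r > 0, ∀ h : H, dist (h • k) k < r → h = 1 := by
  by_contra! hcon
  choose g hg hg1 using fun n : ℕ => hcon (1 / ((n : ℝ) + 1)) Nat.one_div_pos_of_nat
  have hlim : Tendsto (fun n => g n • k) atTop (𝓝 k) :=
    tendsto_iff_dist_tendsto_zero.2 (squeeze_zero (fun _ => dist_nonneg) (fun n => (hg n).le)
      tendsto_one_div_add_atTop_nhds_zero_nat)
  have hK := hlim.isCompact_insert_range
  have hfin := ProperlyDiscontinuousSMul.finite_disjoint_inter_image (Γ := H) hK hK
  have hrange : (range g).Finite := by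
    refine hfin.subset ?_
    rintro _ ⟨n, rfl⟩
    exact ⟨g n • k, ⟨k, mem_insert _ _, rfl⟩, mem_insert_of_mem _ ⟨n, rfl⟩⟩
  have hpos : ∀ n, 0 < dist (g n • k) k := fun n => dist_pos.2 fun h => hg1 n (hfree _ _ h)
  obtain ⟨_, ⟨m, rfl⟩, hm⟩ := exists_min_image (range g) (fun h => dist (h • k) k) hrange
    ⟨g 0, 0, rfl⟩
  obtain ⟨n, hn⟩ := exists_nat_one_div_lt (hpos m)
  exact absurd ((hm (g n) ⟨n, rfl⟩).trans (hg n).le) (not_le.2 hn)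

/-- Pull a Cauchy sequence back to K and pass to a convergent subsequence; the group elements used
are eventually constant, because their quotients move the limit too little. -/
theorem isComplete_orbitSet [IsIsometricSMul H X] (hfree : ∀ (h : H) (x : X), h • x = x → h = 1)
    {K : Set X} (hK : IsCompact K) : IsComplete (orbitSet H K) := by
  rw [← completeSpace_coe_iff_isComplete]
  refine Metric.complete_of_cauchySeq_tendsto fun u hu => ?_
  have hex : ∀ n, ∃ g : H, ∃ k ∈ K, g • k = (u n : X) := fun n => by
    obtain ⟨g, hg⟩ := mem_iUnion.1 (u n).2
    exact ⟨g, hg⟩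
  choose g k hkK hgk using hex
  obtain ⟨k₀, hk₀, φ, hφ, hlim⟩ := hK.tendsto_subseq hkK
  obtain ⟨r, hr, hr1⟩ := exists_ball_forall_eq_one hfree k₀
  obtain ⟨N₁, hN₁⟩ := Metric.cauchySeq_iff.1 hu (r / 3) (by positivity)
  obtain ⟨N₂, hN₂⟩ := Metric.tendsto_atTop.1 hlim (r / 3) (by positivity)
  set N := max N₁ N₂ with hN
  have hconst : ∀ n ≥ N, g (φ n) = g (φ N) := by
    intro n hn
    have h1 : dist (u (φ n) : X) (u (φ N)) < r / 3 :=
      hN₁ _ ((le_max_left _ _).trans (hn.trans (hφ.id_le n))) _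
        ((le_max_left _ _).trans (hφ.id_le N))
    have h2 := hN₂ n ((le_max_right _ _).trans hn)
    have h3 := hN₂ N (le_max_right _ _)
    simp only [Function.comp_apply] at h2 h3
    have h4 : dist (((g (φ N))⁻¹ * g (φ n)) • k₀) k₀ < r := by
      rw [mul_smul, ← dist_smul (g (φ N)), smul_inv_smul]
      have h5 : dist (g (φ n) • k₀) (u (φ n) : X) < r / 3 := by
        rw [← hgk, dist_smul, dist_comm]; exact h2
      have h6 : dist (u (φ N) : X) (g (φ N) • k₀) < r / 3 := by
        rw [← hgk, dist_smul]; exact h3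
      linarith [dist_triangle4 (g (φ n) • k₀) (u (φ n) : X) (u (φ N) : X) (g (φ N) • k₀)]
    exact (inv_mul_eq_one.1 (hr1 _ h4)).symm
  have hmem : g (φ N) • k₀ ∈ orbitSet H K := mem_iUnion.2 ⟨_, k₀, hk₀, rfl⟩
  refine ⟨⟨_, hmem⟩, tendsto_nhds_of_cauchySeq_of_subseq hu hφ.tendsto_atTop ?_⟩
  rw [tendsto_subtype_rng]
  refine Tendsto.congr' ?_ (hlim.const_smul (g (φ N)))
  filter_upwards [eventually_ge_atTop N] with n hn
  simp only [Function.comp_apply]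
  rw [← hgk, hconst n hn]

end Completeness

/-! ### Star-finite covers -/

section Covers

variable {T I : Type*} [PseudoMetricSpace T]

/-- A positivity function of an open set. -/
theorem exists_continuous_pos_iff_mem {U : Set T} (hU : IsOpen U) :
    ∃ f : T → ℝ, Continuous f ∧ (∀ t, 0 ≤ f t) ∧ ∀ t, 0 < f t ↔ t ∈ U := by
  -- Truncation at 1 keeps the value finite when U is the whole space.
  have hne : ∀ t, min 1 (Metric.infEDist t Uᶜ) ≠ ⊤ := fun t =>
    ne_top_of_le_ne_top ENNReal.one_ne_top (min_le_left _ _)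
  refine ⟨fun t => (min 1 (Metric.infEDist t Uᶜ)).toReal, ?_, fun _ => ENNReal.toReal_nonneg,
    fun t => ?_⟩
  · exact ENNReal.continuousOn_toReal.comp_continuous
      (continuous_const.min Metric.continuous_infEDist) hne
  · rw [ENNReal.toReal_pos_iff, lt_min_iff]
    have h1 : Metric.infEDist t Uᶜ = 0 ↔ t ∈ Uᶜ :=
      (Metric.mem_iff_infEDist_zero_of_closed hU.isClosed_compl).symm
    rw [mem_compl_iff] at h1
    constructor
    · rintro ⟨⟨-, h⟩, -⟩
      by_contra ht
      exact h.ne' (h1.2 ht)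
    · intro ht
      exact ⟨⟨zero_lt_one, pos_iff_ne_zero.2 fun h => h1.1 h ht⟩, (hne t).lt_top⟩

/-- A star-finite open cover. -/
structure IsStarFiniteCover (O : I → Set T) : Prop where
  isOpen : ∀ i, IsOpen (O i)
  covers : ∀ t, ∃ i, t ∈ O i
  starFinite : ∀ i, {j | (O i ∩ O j).Nonempty}.Finite

theorem IsStarFiniteCover.finite_mem {O : I → Set T} (hO : IsStarFiniteCover O) (t : T) :
    {i | t ∈ O i}.Finite := by
  obtain ⟨i, hi⟩ := hO.covers t
  exact (hO.starFinite i).subset fun j hj => ⟨t, hi, hj⟩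

end Covers

/-! ### Iterated geodesic joins -/

section Join

variable {X : Type*} [MetricSpace X] {I : Type*}

/-- The iterated geodesic join of the points `v i` for `i` in a list, with weights `w`. -/
noncomputable def join (v : I → X) (x₀ : X) (w : I → ℝ) : List I → X
  | [] => x₀
  | i :: L => seg (join v x₀ w L) (v i) (w i / (w i + (L.map w).sum))

variable {v : I → X} {x₀ : X}

theorem sum_map_nonneg {w : I → ℝ} (hw : ∀ i, 0 ≤ w i) (L : List I) : 0 ≤ (L.map w).sum :=
  List.sum_nonneg fun _ h => by
    obtain ⟨i, -, rfl⟩ := List.mem_map.1 h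
    exact hw i

theorem join_ratio_mem {w : I → ℝ} (hw : ∀ i, 0 ≤ w i) (i : I) (L : List I) :
    w i / (w i + (L.map w).sum) ∈ Icc (0 : ℝ) 1 :=
  ⟨div_nonneg (hw i) (add_nonneg (hw i) (sum_map_nonneg hw L)),
    div_le_one_of_le₀ (le_add_of_nonneg_right (sum_map_nonneg hw L))
      (add_nonneg (hw i) (sum_map_nonneg hw L))⟩

theorem join_mem_of_forall {w : I → ℝ} (hw : ∀ i, 0 ≤ w i) {B : Set X} (hB : SegConvex B)
    (hx₀ : x₀ ∈ B) : ∀ {L : List I}, (∀ i ∈ L, v i ∈ B) → join v x₀ w L ∈ B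
  | [], _ => hx₀
  | i :: L, h => hB _ (join_mem_of_forall hw hB hx₀ fun j hj => h j (List.mem_cons_of_mem _ hj)) _
      (h i List.mem_cons_self) _ (join_ratio_mem hw i L)

theorem join_mem (hX : IsCAT0 X) {w : I → ℝ} (hw : ∀ i, 0 ≤ w i) {B : Set X} (hB : SegConvex B) :
    ∀ {L : List I}, (∀ i ∈ L, 0 < w i → v i ∈ B) → 0 < (L.map w).sum → join v x₀ w L ∈ B
  | [], _, h0 => by simp at h0
  | i :: L, h, h0 => by
    have hL : ∀ j ∈ L, 0 < w j → v j ∈ B := fun j hj => h j (List.mem_cons_of_mem _ hj)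
    rw [join]
    rcases (sum_map_nonneg hw L).eq_or_lt with hs | hs
    · rw [List.map_cons, List.sum_cons, ← hs, add_zero] at h0
      rw [← hs, add_zero, div_self h0.ne', seg_one hX]
      exact h i List.mem_cons_self h0
    · rcases (hw i).eq_or_lt with hi | hi
      · rw [← hi, zero_div, seg_zero hX]
        exact join_mem hX hw hB hL hs
      · exact hB _ (join_mem hX hw hB hL hs) _ (h i List.mem_cons_self hi) _
          (join_ratio_mem hw i L)

theorem sum_map_filter_eq {w : I → ℝ} (p : I → Bool) :
    ∀ {L : List I}, (∀ i ∈ L, p i = false → w i = 0) →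
      ((L.filter p).map w).sum = (L.map w).sum
  | [], _ => rfl
  | i :: L, h => by
    have ih := sum_map_filter_eq p (L := L) fun j hj => h j (List.mem_cons_of_mem _ hj)
    rcases hp : p i with _ | _
    · rw [List.filter_cons_of_neg (by simp [hp]), ih, List.map_cons, List.sum_cons,
        h i List.mem_cons_self hp, zero_add]
    · rw [List.filter_cons_of_pos hp, List.map_cons, List.sum_cons, List.map_cons, List.sum_cons,
        ih]

/-- Vertices of weight zero do not affect the join, so the list may be enlarged by inactive
vertices. -/
theorem join_filter_eq (hX : IsCAT0 X) {w : I → ℝ} (p : I → Bool) :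
    ∀ {L : List I}, (∀ i ∈ L, p i = false → w i = 0) →
      join v x₀ w (L.filter p) = join v x₀ w L
  | [], _ => rfl
  | i :: L, h => by
    have hL : ∀ j ∈ L, p j = false → w j = 0 := fun j hj => h j (List.mem_cons_of_mem _ hj)
    have ih := join_filter_eq hX p hL
    rcases hp : p i with _ | _
    · rw [List.filter_cons_of_neg (by simp [hp]), ih, join, h i List.mem_cons_self hp, zero_div,
        seg_zero hX]
    · rw [List.filter_cons_of_pos hp, join, join, ih, sum_map_filter_eq p hL]

theorem continuousAt_join (hX : IsCAT0 X) {T : Type*} [TopologicalSpace T] {φ : I → T → ℝ}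
    (hφ : ∀ i, Continuous (φ i)) (hφ0 : ∀ i t, 0 ≤ φ i t) {t₀ : T} :
    ∀ {L : List I}, 0 < (L.map fun i => φ i t₀).sum →
      ContinuousAt (fun t => join v x₀ (fun i => φ i t) L) t₀
  | [], h => by simp at h
  | i :: L, h => by
    have hsum : Continuous fun t => (L.map fun i => φ i t).sum := by
      clear h
      induction L with
      | nil => simpa using continuous_const
      | cons j L ih =>
        simp only [List.map_cons, List.sum_cons]
        exact (hφ j).add ih
    have hpos : 0 < φ i t₀ + (L.map fun i => φ i t₀).sum := by simpa using h
    have hratio : ContinuousAt (fun t => φ i t / (φ i t + (L.map fun i => φ i t).sum)) t₀ :=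
      (hφ i).continuousAt.div ((hφ i).add hsum).continuousAt hpos.ne'
    have hmem : ∀ t, φ i t / (φ i t + (L.map fun i => φ i t).sum) ∈ Icc (0 : ℝ) 1 :=
      fun t => join_ratio_mem (fun j => hφ0 j t) i L
    rcases (sum_map_nonneg (fun j => hφ0 j t₀) L).eq_or_lt with hs | hs
    -- Here the remaining vertices have total weight zero and their join may be discontinuous; it
    -- stays bounded while the ratio tends to 1, which suffices.
    · obtain ⟨M, hM⟩ : ∃ M : ℝ, ∀ t, dist (join v x₀ (fun i => φ i t) L) (v i) ≤ M := by
        obtain ⟨M, hM⟩ := ((Set.finite_singleton x₀).union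
          ((L.map v).finite_toSet)).isBounded.subset_closedBall (v i)
        refine ⟨M, fun t => join_mem_of_forall (fun j => hφ0 j t) (segConvex_closedBall hX (v i) M)
          (hM (by simp)) fun j hj => hM (Or.inr ?_)⟩
        exact List.mem_map_of_mem hj
      have h1 : φ i t₀ / (φ i t₀ + (L.map fun i => φ i t₀).sum) = 1 := by
        rw [← hs, add_zero, div_self]
        rw [← hs, add_zero] at hpos
        exact hpos.ne'
      have hval : join v x₀ (fun i => φ i t₀) (i :: L) = v i := by
        rw [join, h1, seg_one hX]
      rw [ContinuousAt, hval, tendsto_iff_dist_tendsto_zero]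
      have hlim : Tendsto (fun t => (1 - φ i t / (φ i t + (L.map fun i => φ i t).sum)) * M)
          (𝓝 t₀) (𝓝 0) := by
        have : ContinuousAt (fun t => (1 - φ i t / (φ i t + (L.map fun i => φ i t).sum)) * M) t₀ :=
          (continuousAt_const.sub hratio).mul continuousAt_const
        rw [ContinuousAt, h1, sub_self, zero_mul] at this
        exact this
      refine squeeze_zero (fun _ => dist_nonneg) (fun t => ?_) hlim
      rw [join, dist_seg_right hX _ _ (hmem t)]
      exact mul_le_mul_of_nonneg_left (hM t) (by linarith [(hmem t).2])
    · exact continuousAt_seg hX (continuousAt_join hX hφ hφ0 hs) continuousAt_const hratio hmem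

open Classical in
/-- A map that sends every point `t` into the convex hull of the points assigned to the members of
the cover containing `t`. -/
theorem IsStarFiniteCover.exists_continuous (hX : IsCAT0 X) {T : Type*} [PseudoMetricSpace T]
    {O : I → Set T} (hO : IsStarFiniteCover O) (v : I → X) :
    ∃ g : T → X, Continuous g ∧
      ∀ t, ∀ B : Set X, SegConvex B → (∀ i, t ∈ O i → v i ∈ B) → g t ∈ B := by
  rcases isEmpty_or_nonempty T with hT | ⟨⟨t₁⟩⟩
  · exact ⟨fun t => isEmptyElim t, continuous_of_const fun t => isEmptyElim t,
      fun t => isEmptyElim t⟩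
  obtain ⟨i₁, -⟩ := hO.covers t₁
  -- The join depends on the order of its vertices. A single global order makes the lists at nearby
  -- points sublists of one fixed finite list.
  let : LinearOrder I := linearOrderOfSTO (WellOrderingRel (α := I))
  choose φ hφ hφ0 hφpos using fun i => exists_continuous_pos_iff_mem (hO.isOpen i)
  have hzero : ∀ i t, t ∉ O i → φ i t = 0 := fun i t h =>
    le_antisymm (not_lt.1 fun h' => h ((hφpos i t).1 h')) (hφ0 i t)
  have hsum : ∀ t (F : Finset I) (i : I), i ∈ F → t ∈ O i →
      0 < (F.sort.map fun i => φ i t).sum := by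
    intro t F i hi ht
    refine ((hφpos i t).2 ht).trans_le (List.single_le_sum ?_ _ ?_)
    · intro x hx
      obtain ⟨j, -, rfl⟩ := List.mem_map.1 hx
      exact hφ0 j t
    · exact List.mem_map.2 ⟨i, (Finset.mem_sort _).2 hi, rfl⟩
  set g : T → X := fun t => join v (v i₁) (fun i => φ i t) (hO.finite_mem t).toFinset.sort with hg
  refine ⟨g, continuous_iff_continuousAt.2 fun t₀ => ?_, fun t B hB h => ?_⟩
  · obtain ⟨i₀, hi₀⟩ := hO.covers t₀
    have hF : i₀ ∈ (hO.starFinite i₀).toFinset := by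
      rw [Finite.mem_toFinset]; exact ⟨t₀, hi₀, hi₀⟩
    refine (continuousAt_join hX hφ hφ0 (v := v) (x₀ := v i₁) (hsum t₀ _ i₀ hF hi₀)).congr ?_
    filter_upwards [(hO.isOpen i₀).mem_nhds hi₀] with t ht
    have hlist : (hO.finite_mem t).toFinset.sort =
        (hO.starFinite i₀).toFinset.sort.filter (fun i => decide (t ∈ O i)) := by
      refine List.Perm.eq_of_pairwise' (r := (· ≤ ·)) (Finset.pairwise_sort _ _)
        ((Finset.pairwise_sort _ _).filter _) ?_
      refine (List.perm_ext_iff_of_nodup (Finset.sort_nodup _ _)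
        ((Finset.sort_nodup _ _).filter _)).2 fun i => ?_
      simp only [Finset.mem_sort, Finite.mem_toFinset, mem_ofPred_eq, List.mem_filter,
        decide_eq_true_eq]
      exact ⟨fun h => ⟨⟨t, ht, h⟩, h⟩, fun h => h.2⟩
    simp only [hg]
    rw [hlist, join_filter_eq hX]
    intro i _ hi
    exact hzero i t (of_decide_eq_false hi)
  · obtain ⟨i, hi⟩ := hO.covers t
    refine join_mem hX (fun i => hφ0 i t) hB (fun j _ hj => h j ((hφpos j t).1 hj))
      (hsum t _ i ?_ hi)
    rw [Finite.mem_toFinset]; exact hi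

end Join

/-! ### Barycentric subdivision of the nerve -/

section Subdivision

/-- Recursive choice along a well-founded relation, where the condition on the value at `a` depends
on the values chosen before. -/
theorem exists_recursive_choice {A B : Type*} {r : A → A → Prop} (hr : WellFounded r) (x₀ : B)
    (good : (A → B) → A → B → Prop)
    (hloc : ∀ a b b', (∀ c, r c a → b c = b' c) → ∀ x, good b a x → good b' a x) :
    ∃ b : A → B, ∀ a, (b a = x₀ ∨ good b a (b a)) ∧ ((∃ x, good b a x) → good b a (b a)) := by
  classical
  -- Values not chosen yet are filled in by x₀; by `hloc` they do not matter.
  let extend (a : A) (prev : ∀ c, r c a → B) : A → B := fun c => if h : r c a then prev c h else x₀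
  let F : ∀ a, (∀ c, r c a → B) → B := fun a prev =>
    if h : ∃ x, good (extend a prev) a x then h.choose else x₀
  let b : A → B := hr.fix F
  have hextend : ∀ a c, r c a → extend a (fun c _ => b c) c = b c := fun a c h => dif_pos h
  have hb : ∀ a, b a = F a fun c _ => b c := fun a => hr.fix_eq F a
  refine ⟨b, fun a => ?_⟩
  by_cases h : ∃ x, good (extend a fun c _ => b c) a x
  · have h1 : good b a (b a) := by
      refine hloc a _ b (fun c hc => hextend a c hc) _ ?_
      rw [hb a]
      simp only [F]
      rw [dif_pos h]
      exact h.choose_spec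
    exact ⟨Or.inr h1, fun _ => h1⟩
  · refine ⟨Or.inl ?_, fun ⟨x, hx⟩ => absurd ⟨x, ?_⟩ h⟩
    · rw [hb a]
      simp only [F]
      rw [dif_neg h]
    · exact hloc a b _ (fun c hc => (hextend a c hc).symm) x hx

variable {I : Type*}

/-- A well-order of the finite subsets of `I` that refines the order by cardinality. -/
def cardLex (ρ σ : Finset I) : Prop :=
  Prod.Lex (· < ·) WellOrderingRel (ρ.card, ρ) (σ.card, σ)

theorem wellFounded_cardLex : WellFounded (cardLex (I := I)) :=
  InvImage.wf (fun σ : Finset I => (σ.card, σ))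
    (WellFounded.prod_lex wellFounded_lt WellOrderingRel.isWellOrder.wf)

theorem cardLex_of_ssubset {τ σ : Finset I} (h : τ ⊂ σ) : cardLex τ σ :=
  Prod.Lex.left _ _ (Finset.card_lt_card h)

theorem cardLex_trichotomous (τ σ : Finset I) : cardLex τ σ ∨ τ = σ ∨ cardLex σ τ := by
  rcases lt_trichotomy τ.card σ.card with h | h | h
  · exact Or.inl (Prod.Lex.left _ _ h)
  · rcases trichotomous_of WellOrderingRel τ σ with h' | h' | h'
    · exact Or.inl (by rw [cardLex, h]; exact Prod.Lex.right _ h')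
    · exact Or.inr (Or.inl h')
    · exact Or.inr (Or.inr (by rw [cardLex, h]; exact Prod.Lex.right _ h'))
  · exact Or.inr (Or.inr (Prod.Lex.left _ _ h))

variable {T : Type*} {O : I → Set T}

/-- The finite set `σ` spans a simplex of the nerve of the indexed family `O`. -/
def Spans (O : I → Set T) (σ : Finset I) : Prop := σ.Nonempty ∧ ∃ t, ∀ i ∈ σ, t ∈ O i

theorem Spans.mono {σ τ : Finset I} (h : Spans O σ) (hτ : τ.Nonempty) (hτσ : τ ⊆ σ) : Spans O τ :=
  ⟨hτ, h.2.imp fun _ ht i hi => ht i (hτσ hi)⟩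

open Classical in
/-- Barycenters of the simplices of a star-finite nerve, chosen compatibly. -/
theorem exists_barycenters {X : Type*} [MetricSpace X] [PseudoMetricSpace T] {Z : Set X}
    {lam Δ : ℝ} (hlam0 : 0 ≤ lam) (hZ : HasBarycenters lam Δ Z) (hO : IsStarFiniteCover O)
    {v : I → X} (hv : ∀ i, v i ∈ Z) (hne : Z.Nonempty)
    (hΔ : ∀ t i j, t ∈ O i → t ∈ O j → dist (v i) (v j) ≤ Δ) :
    ∃ b : Finset I → X, (∀ σ, b σ ∈ Z) ∧
      ∀ ω, Spans O ω → ∀ E, (∀ i ∈ ω, ∀ j ∈ ω, dist (v i) (v j) ≤ E) →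
        ∀ σ ⊆ ω, σ.Nonempty → (∀ i ∈ ω, dist (b σ) (v i) ≤ E) ∧
          ∀ τ ⊂ σ, τ.Nonempty → dist (b σ) (b τ) ≤ lam * E := by
  obtain ⟨x₀, hx₀⟩ := hne
  let P (b : Finset I → X) (σ : Finset I) : Set X := v '' σ ∪ b '' {τ | τ.Nonempty ∧ τ ⊂ σ}
  -- Besides the vertices and the barycenters of proper faces of σ, collected in P, the new
  -- barycenter is tested against all adjacent vertices and all earlier barycenters in common
  -- cofaces. This keeps later sets P and Q small.
  let Q (b : Finset I → X) (σ : Finset I) : Set X :=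
    v '' {j | Spans O (insert j σ)} ∪ b '' {ρ | ρ.Nonempty ∧ cardLex ρ σ ∧ Spans O (σ ∪ ρ)}
  obtain ⟨b, hb⟩ := exists_recursive_choice wellFounded_cardLex x₀
    (fun b σ x => x ∈ Z ∧ IsBarycenter lam (P b σ) (Q b σ) x) (by
      intro σ b b' h x hx
      have hP : P b σ = P b' σ := congrArg₂ (· ∪ ·) rfl
        (image_congr fun τ hτ => h τ (cardLex_of_ssubset hτ.2))
      have hQ : Q b σ = Q b' σ := congrArg₂ (· ∪ ·) rfl
        (image_congr fun τ hτ => h τ hτ.2.1)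
      rwa [hP, hQ] at hx)
  have hbZ : ∀ σ, b σ ∈ Z := fun σ => (hb σ).1.elim (fun h => h ▸ hx₀) fun h => h.1
  have hP_nonempty : ∀ σ : Finset I, σ.Nonempty → (P b σ).Nonempty := fun σ ⟨i, hi⟩ =>
    ⟨v i, Or.inl ⟨i, hi, rfl⟩⟩
  have hP_finite : ∀ σ, (P b σ).Finite := fun σ => (σ.finite_toSet.image v).union
    ((σ.powerset.finite_toSet.subset fun τ hτ => by simpa using hτ.2.subset).image b)
  have hQ_finite : ∀ σ : Finset I, σ.Nonempty → (Q b σ).Finite := by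
    rintro σ ⟨i, hi⟩
    refine Finite.union (((hO.starFinite i).subset ?_).image v)
      (((hO.starFinite i).toFinset.powerset.finite_toSet.subset ?_).image b)
    · rintro j ⟨-, t, ht⟩
      exact ⟨t, ht i (Finset.mem_insert_of_mem hi), ht j (Finset.mem_insert_self _ _)⟩
    · rintro ρ ⟨-, -, -, t, ht⟩
      simp only [Finset.coe_powerset, mem_preimage, mem_powerset_iff]
      intro j hj
      rw [Finset.mem_coe, Finite.mem_toFinset]
      exact ⟨t, ht i (Finset.mem_union_left _ hi), ht j (Finset.mem_union_right _ hj)⟩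
  have hPZ : ∀ σ, P b σ ⊆ Z := by
    rintro σ _ (⟨i, -, rfl⟩ | ⟨τ, -, rfl⟩)
    exacts [hv i, hbZ τ]
  have hQZ : ∀ σ, Q b σ ⊆ Z := by
    rintro σ _ (⟨i, -, rfl⟩ | ⟨τ, -, rfl⟩)
    exacts [hv i, hbZ τ]
  have main : ∀ σ : Finset I, ∀ ω, Spans O ω → σ ⊆ ω → σ.Nonempty →
      ∀ E, (∀ i ∈ ω, ∀ j ∈ ω, dist (v i) (v j) ≤ E) →
      (∀ i ∈ ω, dist (b σ) (v i) ≤ E) ∧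
      (∀ ρ ⊆ ω, ρ.Nonempty → cardLex ρ σ → dist (b σ) (b ρ) ≤ E) ∧
      ∀ τ ⊂ σ, τ.Nonempty → dist (b σ) (b τ) ≤ lam * E := by
    intro σ
    induction σ using wellFounded_cardLex.induction with
    | _ σ ih =>
    intro ω hω hσω hσ E hE
    let R (ω : Finset I) : Set X := v '' ω ∪ b '' {ρ | ρ.Nonempty ∧ ρ ⊆ ω ∧ cardLex ρ σ}
    have hR : ∀ ω, Spans O ω → ∀ E, (∀ i ∈ ω, ∀ j ∈ ω, dist (v i) (v j) ≤ E) →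
        ∀ x ∈ R ω, ∀ y ∈ R ω, dist x y ≤ E := by
      rintro ω hω E hE _ (⟨i, hi, rfl⟩ | ⟨ρ, ⟨hρ, hρω, hρσ⟩, rfl⟩) _
        (⟨j, hj, rfl⟩ | ⟨τ, ⟨hτ, hτω, hτσ⟩, rfl⟩)
      · exact hE i hi j hj
      · rw [dist_comm]
        exact (ih τ hτσ ω hω hτω hτ E hE).1 i hi
      · exact (ih ρ hρσ ω hω hρω hρ E hE).1 j hj
      · rcases cardLex_trichotomous τ ρ with h | rfl | h
        · exact (ih ρ hρσ ω hω hρω hρ E hE).2.1 τ hτω hτ h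
        · rw [dist_self]
          obtain ⟨i, hi⟩ := hω.1
          exact dist_nonneg.trans (hE i hi i hi)
        · rw [dist_comm]
          exact (ih τ hτσ ω hω hτω hτ E hE).2.1 ρ hρω hρ h
    have hPR : ∀ ω, σ ⊆ ω → P b σ ⊆ R ω := by
      rintro ω hσω _ (⟨i, hi, rfl⟩ | ⟨τ, ⟨hτ, hτσ⟩, rfl⟩)
      · exact Or.inl ⟨i, hσω hi, rfl⟩
      · exact Or.inr ⟨τ, ⟨hτ, hτσ.subset.trans hσω, cardLex_of_ssubset hτσ⟩, rfl⟩
    have hQR : ∀ q ∈ Q b σ, ∃ ω, Spans O ω ∧ σ ⊆ ω ∧ q ∈ R ω := by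
      rintro _ (⟨j, hj, rfl⟩ | ⟨ρ, ⟨hρ, hρσ, hσρ⟩, rfl⟩)
      · exact ⟨_, hj, Finset.subset_insert _ _, Or.inl ⟨j, Finset.mem_insert_self _ _, rfl⟩⟩
      · exact ⟨_, hσρ, Finset.subset_union_left,
          Or.inr ⟨ρ, ⟨hρ, Finset.subset_union_right, hρσ⟩, rfl⟩⟩
    have hRQ : ∀ ω, Spans O ω → σ ⊆ ω → R ω ⊆ Q b σ := by
      rintro ω hω hσω _ (⟨j, hj, rfl⟩ | ⟨ρ, ⟨hρ, hρω, hρσ⟩, rfl⟩)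
      · exact Or.inl ⟨j, hω.mono (Finset.insert_nonempty _ _) (Finset.insert_subset hj hσω), rfl⟩
      · exact Or.inr ⟨ρ, ⟨hρ, hρσ, hω.mono (hσ.mono Finset.subset_union_left)
          (Finset.union_subset hσω hρω)⟩, rfl⟩
    have hΔω : ∀ ω, Spans O ω → ∀ i ∈ ω, ∀ j ∈ ω, dist (v i) (v j) ≤ Δ :=
      fun ω ⟨_, t, ht⟩ i hi j hj => hΔ t i j (ht i hi) (ht j hj)
    have hσs : Spans O σ := hω.mono hσ hσω
    obtain ⟨p₀, hp₀⟩ := hP_nonempty σ hσ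
    have hΔ0 : 0 ≤ Δ := dist_nonneg.trans (hR σ hσs Δ (hΔω σ hσs) p₀ (hPR σ subset_rfl hp₀) p₀
      (hPR σ subset_rfl hp₀))
    -- Points of Q may lie in different cofaces of σ, so they are compared through a point of P;
    -- hence the bound 2Δ.
    have hQP : ∀ q ∈ Q b σ, dist q p₀ ≤ Δ := fun q hq => by
      obtain ⟨ω', hω', hσω', hqω'⟩ := hQR q hq
      exact hR ω' hω' Δ (hΔω ω' hω') q hqω' p₀ (hPR ω' hσω' hp₀)
    have hPQ : P b σ ⊆ Q b σ := (hPR σ subset_rfl).trans (hRQ σ hσs subset_rfl)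
    have hex : ∃ x, x ∈ Z ∧ IsBarycenter lam (P b σ) (Q b σ) x := by
      refine hZ (P b σ) (Q b σ) (hPZ σ) (hQZ σ) (hP_finite σ) (hQ_finite σ hσ) ⟨p₀, hp₀⟩ ?_ ?_
      · exact Metric.diam_le_of_forall_dist_le hΔ0 fun x hx y hy =>
          hR σ hσs Δ (hΔω σ hσs) x (hPR σ subset_rfl hx) y (hPR σ subset_rfl hy)
      · rw [union_eq_self_of_subset_left hPQ]
        refine Metric.diam_le_of_forall_dist_le (by positivity) fun x hx y hy => ?_
        linarith [dist_triangle_right x y p₀, hQP x hx, hQP y hy]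
    have hbar := ((hb σ).2 hex).2
    have hE0 : 0 ≤ E := by
      obtain ⟨i, hi⟩ := hω.1
      exact dist_nonneg.trans (hE i hi i hi)
    -- The barycenter bounds refer to the diameter of P with one point added, which lies in a single
    -- coface ω. Thus one choice of b serves every ω and every E, both the global bound and the
    -- smaller one over the boundary.
    have hfar : ∀ q ∈ R ω, dist (b σ) q ≤ E := fun q hq =>
      (hbar.2 q (hRQ ω hω hσω hq)).trans
        (Metric.diam_le_of_forall_dist_le hE0 fun x hx y hy => hR ω hω E hE x
          (insert_subset hq (hPR ω hσω) hx) y (insert_subset hq (hPR ω hσω) hy))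
    refine ⟨fun i hi => hfar _ (Or.inl ⟨i, hi, rfl⟩),
      fun ρ hρω hρ hρσ => hfar _ (Or.inr ⟨ρ, ⟨hρ, hρω, hρσ⟩, rfl⟩), fun τ hτσ hτ => ?_⟩
    refine (hbar.1 _ (Or.inr ⟨τ, ⟨hτ, hτσ⟩, rfl⟩)).trans (mul_le_mul_of_nonneg_left ?_ hlam0)
    exact Metric.diam_le_of_forall_dist_le hE0 fun x hx y hy =>
      hR ω hω E hE x (hPR ω hσω hx) y (hPR ω hσω hy)
  exact ⟨b, hbZ, fun ω hω E hE σ hσω hσ =>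
    ⟨(main σ ω hω hσω hσ E hE).1, (main σ ω hω hσω hσ E hE).2.2⟩⟩

open Classical in
/-- Subdivision of a star-finite cover, with vertices that are closer to one another. -/
theorem IsStarFiniteCover.exists_subdivision {X : Type*} [MetricSpace X] [PseudoMetricSpace T]
    {Z : Set X} {lam Δ : ℝ} (hlam0 : 0 ≤ lam) (hZ : HasBarycenters lam Δ Z)
    (hO : IsStarFiniteCover O) {v : I → X} (hv : ∀ i, v i ∈ Z) (hne : Z.Nonempty)
    (hΔ : ∀ t i j, t ∈ O i → t ∈ O j → dist (v i) (v j) ≤ Δ) :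
    ∃ (O' : Finset I → Set T) (b : Finset I → X), IsStarFiniteCover O' ∧ (∀ σ, b σ ∈ Z) ∧
      ∀ t E, (∀ i j, t ∈ O i → t ∈ O j → dist (v i) (v j) ≤ E) →
        (∀ σ i, t ∈ O' σ → t ∈ O i → dist (b σ) (v i) ≤ E) ∧
        ∀ σ τ, t ∈ O' σ → t ∈ O' τ → dist (b σ) (b τ) ≤ lam * E := by
  obtain ⟨b, hbZ, hb⟩ := exists_barycenters hlam0 hZ hO hv hne hΔ
  choose φ hφ hφ0 hφpos using fun i => exists_continuous_pos_iff_mem (hO.isOpen i)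
  have hzero : ∀ i t, t ∉ O i → φ i t = 0 := fun i t h =>
    le_antisymm (not_lt.1 fun h' => h ((hφpos i t).1 h')) (hφ0 i t)
  -- An open form of the barycentric subdivision: the weights in σ dominate all others. Sets σ and τ
  -- sharing a point are nested, like vertices of a simplex in the subdivision.
  let O' : Finset I → Set T := fun σ =>
    {t | σ.Nonempty ∧ ∀ i ∈ σ, 0 < φ i t ∧ ∀ j ∉ σ, φ j t < φ i t}
  have hsub : ∀ {σ t i}, t ∈ O' σ → i ∈ σ → t ∈ O i := fun ht hi => (hφpos _ _).1 (ht.2 _ hi).1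
  have hchain : ∀ {σ τ t}, t ∈ O' σ → t ∈ O' τ → σ ⊆ τ ∨ τ ⊆ σ := by
    intro σ τ t hσ hτ
    by_contra! h
    obtain ⟨i, hiσ, hiτ⟩ := Finset.not_subset.1 h.1
    obtain ⟨j, hjτ, hjσ⟩ := Finset.not_subset.1 h.2
    exact lt_asymm ((hσ.2 i hiσ).2 j hjσ) ((hτ.2 j hjτ).2 i hiτ)
  refine ⟨O', b, ⟨fun σ => ?_, fun t => ?_, fun σ => ?_⟩, hbZ, fun t E hE => ?_⟩
  · rw [isOpen_iff_mem_nhds]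
    rintro t₀ ⟨hσ, h⟩
    obtain ⟨i₀, hi₀⟩ := hO.covers t₀
    have e1 : ∀ᶠ t in 𝓝 t₀, ∀ i ∈ σ, 0 < φ i t ∧
        ∀ j ∈ (hO.starFinite i₀).toFinset \ σ, φ j t < φ i t := by
      rw [Filter.eventually_all_finset]
      intro i hi
      refine ((hφ i).continuousAt.eventually_const_lt (h i hi).1).and ?_
      rw [Filter.eventually_all_finset]
      intro j hj
      exact (hφ j).continuousAt.eventually_lt (hφ i).continuousAt
        ((h i hi).2 j (Finset.mem_sdiff.1 hj).2)
    filter_upwards [e1, (hO.isOpen i₀).mem_nhds hi₀] with t ht hti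
    refine ⟨hσ, fun i hi => ⟨(ht i hi).1, fun j hj => ?_⟩⟩
    by_cases hjt : t ∈ O j
    · exact (ht i hi).2 j (Finset.mem_sdiff.2 ⟨(Finite.mem_toFinset _).2 ⟨t, hti, hjt⟩, hj⟩)
    · rw [hzero j t hjt]; exact (ht i hi).1
  · obtain ⟨i₀, hi₀⟩ := hO.covers t
    obtain ⟨m, hm, hmax⟩ := Finset.exists_max_image (hO.finite_mem t).toFinset (fun i => φ i t)
      ⟨i₀, (Finite.mem_toFinset _).2 hi₀⟩
    have hm' : t ∈ O m := (Finite.mem_toFinset (hO.finite_mem t)).1 hm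
    -- The indices of maximal weight at t span a vertex whose set contains t.
    refine ⟨(hO.finite_mem t).toFinset.filter fun i => φ i t = φ m t,
      ⟨m, Finset.mem_filter.2 ⟨hm, rfl⟩⟩, fun i hi => ?_⟩
    rw [(Finset.mem_filter.1 hi).2]
    refine ⟨(hφpos m t).2 hm', fun j hj => ?_⟩
    by_cases hjt : t ∈ O j
    · have hj' : j ∈ (hO.finite_mem t).toFinset := (Finite.mem_toFinset _).2 hjt
      exact (hmax j hj').lt_of_ne fun h => hj (Finset.mem_filter.2 ⟨hj', h⟩)
    · rw [hzero j t hjt]; exact (hφpos m t).2 hm'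
  · rcases σ.eq_empty_or_nonempty with rfl | ⟨i, hi⟩
    · refine Set.finite_empty.subset ?_
      rintro τ ⟨t, ht, -⟩
      exact absurd ht.1 Finset.not_nonempty_empty
    · refine (hO.starFinite i).toFinset.powerset.finite_toSet.subset ?_
      rintro τ ⟨t, ht, ht'⟩
      simp only [Finset.coe_powerset, mem_preimage, mem_powerset_iff]
      intro j hj
      rw [Finset.mem_coe, Finite.mem_toFinset]
      exact ⟨t, hsub ht hi, hsub ht' hj⟩
  · have hE0 : 0 ≤ E := by
      obtain ⟨i, hi⟩ := hO.covers t
      exact dist_nonneg.trans (hE i i hi hi)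
    obtain ⟨i₀, hi₀⟩ := hO.covers t
    have hmem : ∀ {i}, i ∈ (hO.finite_mem t).toFinset ↔ t ∈ O i := Finite.mem_toFinset _
    have key := hb (hO.finite_mem t).toFinset ⟨⟨i₀, hmem.2 hi₀⟩, t, fun i hi => hmem.1 hi⟩ E
      fun i hi j hj => hE i j (hmem.1 hi) (hmem.1 hj)
    have hle : ∀ {σ}, t ∈ O' σ → σ ⊆ (hO.finite_mem t).toFinset := fun hσ i hi =>
      hmem.2 (hsub hσ hi)
    refine ⟨fun σ i hσ hi => (key σ (hle hσ) hσ.1).1 i (hmem.2 hi), fun σ τ hσ hτ => ?_⟩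
    rcases eq_or_ne σ τ with rfl | hne'
    · rw [dist_self]; positivity
    · rcases hchain hσ hτ with h | h
      · rw [dist_comm]
        exact (key τ (hle hτ) hτ.1).2 σ (h.ssubset_of_ne hne') hσ.1
      · exact (key σ (hle hσ) hσ.1).2 τ (h.ssubset_of_ne hne'.symm) hτ.1

end Subdivision

/-! ### Filling maps by repeated subdivision -/

section Filling

variable {X : Type*} [MetricSpace X]

/-- Balls are convex, so the geodesic homotopy stays in the ball that contains both values, hence in
W. -/
theorem homotopic_of_mem_closedBall (hX : IsCAT0 X) {W Z : Set X} {r : ℝ}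
    (hball : ∀ z ∈ Z, Metric.closedBall z r ⊆ W) {A : Type*} [TopologicalSpace A] {f g : C(A, W)}
    (h : ∀ a, ∃ z ∈ Z, (f a : X) ∈ Metric.closedBall z r ∧ (g a : X) ∈ Metric.closedBall z r) :
    f.Homotopic g := by
  have hcont : Continuous fun p : unitInterval × A => seg (f p.2 : X) (g p.2) p.1 :=
    continuous_seg hX (by fun_prop) (by fun_prop) (by fun_prop) fun p => p.1.2
  have hmem : ∀ p : unitInterval × A, seg (f p.2 : X) (g p.2) p.1 ∈ W := fun p => by
    obtain ⟨z, hz, hf, hg⟩ := h p.2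
    exact hball z hz (segConvex_closedBall hX z r _ hf _ hg _ p.1.2)
  exact ⟨⟨⟨fun p => ⟨_, hmem p⟩, hcont.subtype_mk hmem⟩, fun a => Subtype.ext (seg_zero hX _ _),
    fun a => Subtype.ext (seg_one hX _ _)⟩⟩

/-- A map that is controlled by the vertices of the nerve of a star-finite cover extends, up to
homotopy, if the vertices lie in a set with barycenters. -/
theorem exists_filling (hX : IsCAT0 X) {W Z : Set X} {lam Δ r : ℝ} (hlam0 : 0 ≤ lam)
    (hlam1 : lam ≤ 1) (hZ : HasBarycenters lam Δ Z) (hne : Z.Nonempty)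
    (hball : ∀ z ∈ Z, Metric.closedBall z r ⊆ W) {A T : Type*} [TopologicalSpace A]
    [PseudoMetricSpace T] (j : C(A, T)) (n : ℕ) : ∀ {I : Type*} {O : I → Set T}
    (_ : IsStarFiniteCover O) {v : I → X} (_ : ∀ i, v i ∈ Z) {E : ℝ}
    (_ : ∀ t i k, t ∈ O i → t ∈ O k → dist (v i) (v k) ≤ E) (_ : E ≤ Δ) (_ : lam ^ n * E ≤ r)
    (_ : ∀ a i k, j a ∈ O i → j a ∈ O k → dist (v i) (v k) ≤ r) (g : C(A, W))
    (_ : ∀ a, ∀ B : Set X, SegConvex B → (∀ i, j a ∈ O i → v i ∈ B) → (g a : X) ∈ B),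
    ∃ G : C(T, W), (G.comp j).Homotopic g := by
  induction n with
  | zero =>
    intro I O hO v hv E hE _ hEr _ g hg
    obtain ⟨G, hGc, hG⟩ := hO.exists_continuous hX v
    have hEr' : E ≤ r := by simpa using hEr
    have hvball : ∀ t i, t ∈ O i → ∀ k, t ∈ O k → v k ∈ Metric.closedBall (v i) r :=
      fun t i hi k hk => (hE t k i hk hi).trans hEr'
    have hGW : ∀ t, G t ∈ W := fun t => by
      obtain ⟨i, hi⟩ := hO.covers t
      exact hball _ (hv i) (hG t _ (segConvex_closedBall hX _ _) (hvball t i hi))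
    refine ⟨⟨fun t => ⟨G t, hGW t⟩, hGc.subtype_mk hGW⟩,
      homotopic_of_mem_closedBall hX hball fun a => ?_⟩
    obtain ⟨i, hi⟩ := hO.covers (j a)
    exact ⟨v i, hv i, hG _ _ (segConvex_closedBall hX _ _) (hvball _ i hi),
      hg _ _ (segConvex_closedBall hX _ _) (hvball _ i hi)⟩
  | succ n ih =>
    intro I O hO v hv E hE hEΔ hEr hr g hg
    obtain ⟨O', b, hO', hb, hsub⟩ := hO.exists_subdivision hlam0 hZ hv hne
      fun t i k hi hk => (hE t i k hi hk).trans hEΔ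
    obtain ⟨f, hfc, hf⟩ := hO'.exists_continuous hX b
    have hbball : ∀ a i, j a ∈ O i → ∀ σ, j a ∈ O' σ → b σ ∈ Metric.closedBall (v i) r :=
      fun a i hi σ hσ => (hsub (j a) r (hr a)).1 σ i hσ hi
    have hfball : ∀ a i, j a ∈ O i → f (j a) ∈ Metric.closedBall (v i) r := fun a i hi =>
      hf _ _ (segConvex_closedBall hX _ _) (hbball a i hi)
    have hfW : ∀ a, f (j a) ∈ W := fun a => by
      obtain ⟨i, hi⟩ := hO.covers (j a)
      exact hball _ (hv i) (hfball a i hi)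
    -- The subdivided vertices control g' but not g, so the induction continues with g'. Both maps
    -- take values in a common r-ball around an old vertex and are therefore homotopic in W.
    let g' : C(A, W) := ⟨fun a => ⟨f (j a), hfW a⟩, (hfc.comp j.continuous).subtype_mk hfW⟩
    have hg' : g'.Homotopic g := homotopic_of_mem_closedBall hX hball fun a => by
      obtain ⟨i, hi⟩ := hO.covers (j a)
      exact ⟨v i, hv i, hfball a i hi, hg _ _ (segConvex_closedBall hX _ _)
        fun k hk => hr a k i hk hi⟩
    rcases isEmpty_or_nonempty T with hT | ⟨⟨t⟩⟩
    · have : IsEmpty A := ⟨fun a => hT.false (j a)⟩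
      exact ⟨⟨fun t => isEmptyElim t, continuous_of_const fun t => isEmptyElim t⟩,
        homotopic_of_mem_closedBall hX hball fun a => isEmptyElim a⟩
    have hE0 : 0 ≤ E := by
      obtain ⟨i, hi⟩ := hO.covers t
      exact dist_nonneg.trans (hE t i i hi hi)
    obtain ⟨G, hG⟩ := ih hO' hb (E := lam * E) (fun t σ τ => (hsub t E (hE t)).2 σ τ)
      ((mul_le_of_le_one_left hE0 hlam1).trans hEΔ) (by rw [← mul_assoc, ← pow_succ]; exact hEr)
      (fun a σ τ hσ hτ => by
        refine ((hsub (j a) r (hr a)).2 σ τ hσ hτ).trans (mul_le_of_le_one_left ?_ hlam1)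
        obtain ⟨i, hi⟩ := hO.covers (j a)
        exact dist_nonneg.trans (hr a i i hi hi)) g'
      fun a B hB h => hf _ B hB h
    exact ⟨G, hG.trans hg'⟩

end Filling

/-! ### Contractibility of convex sets and of components -/

section Components

theorem contractibleSpace_of_segConvex {X : Type*} [MetricSpace X] (hX : IsCAT0 X) {D : Set X}
    (hD : SegConvex D) (hne : D.Nonempty) : ContractibleSpace D := by
  obtain ⟨c, hc⟩ := hne
  rw [contractible_iff_id_nullhomotopic]
  have hcont : Continuous fun p : unitInterval × D => seg (p.2 : X) c p.1 :=
    continuous_seg hX (by fun_prop) (by fun_prop) (by fun_prop) fun p => p.1.2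
  exact ⟨⟨c, hc⟩, ⟨⟨⟨fun p => ⟨seg (p.2 : X) c p.1, hD _ p.2.2 _ hc _ p.1.2⟩, hcont.subtype_mk _⟩,
    fun a => Subtype.ext (seg_zero hX _ _), fun a => Subtype.ext (seg_one hX _ _)⟩⟩⟩

/-- A connected component of `F` is contractible if its inclusion into `F` is nullhomotopic. -/
theorem contractibleSpace_of_nullhomotopic_inclusion {X : Type*} [TopologicalSpace X] {F S : Set X}
    (hS : ∃ x ∈ F, S = connectedComponentIn F x) (hSF : S ⊆ F)
    (h : (⟨inclusion hSF, continuous_inclusion hSF⟩ : C(S, F)).Nullhomotopic) :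
    ContractibleSpace S := by
  obtain ⟨x, hx, rfl⟩ := hS
  obtain ⟨c, ⟨Φ⟩⟩ := h
  -- The track of a point is connected and starts in the component.
  have hmem : ∀ p, (Φ p : X) ∈ connectedComponentIn F x := by
    rintro ⟨u, s⟩
    have hcont : Continuous fun u : unitInterval => (Φ (u, s) : X) := by fun_prop
    have hpre : IsPreconnected (range fun u : unitInterval => (Φ (u, s) : X)) :=
      isPreconnected_range hcont
    have hsub : connectedComponentIn F (s : X) ⊆ connectedComponentIn F x :=
      (connectedComponentIn_eq s.2).ge
    refine hsub (hpre.subset_connectedComponentIn ⟨0, ?_⟩ ?_ ⟨u, rfl⟩)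
    · simp
    · rintro _ ⟨u, rfl⟩
      exact (Φ (u, s)).2
  have hc : (c : X) ∈ connectedComponentIn F x := by
    have := hmem (1, ⟨x, mem_connectedComponentIn hx⟩)
    simpa using this
  rw [contractible_iff_id_nullhomotopic]
  refine ⟨⟨c, hc⟩, ⟨⟨⟨fun p => ⟨Φ p, hmem p⟩, ?_⟩, fun a => ?_, fun a => ?_⟩⟩⟩
  · exact (continuous_subtype_val.comp Φ.continuous).subtype_mk _
  · apply Subtype.ext; simp
  · apply Subtype.ext; simp

end Components

/-! ### The cover by translates -/

section Nerve

variable {X : Type*} [MetricSpace X] {H : Type*} [Group H] [MulAction H X]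

theorem inter_nonempty_of_dist_le {K : Set X} {δ : ℝ}
    (hsep : ∀ h : H, (h • K) ∩ K = ∅ → 2 * δ < sInf {r | ∃ p ∈ K, ∃ q ∈ h • K, r = dist p q})
    {g : H} {k k' : X} (hk : k ∈ K) (hk' : k' ∈ K) (h : dist k (g • k') ≤ 2 * δ) :
    ((g • K) ∩ K).Nonempty := by
  by_contra hne
  refine absurd (hsep g (not_nonempty_iff_eq_empty.1 hne))
    (not_lt.2 ((csInf_le ⟨0, ?_⟩ ?_).trans h))
  · rintro _ ⟨p, -, q, -, rfl⟩
    exact dist_nonneg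
  · exact ⟨k, hk, g • k', smul_mem_smul_set hk', rfl⟩

theorem finite_smul_inter_nonempty [ProperlyDiscontinuousSMul H X] {K : Set X} (hK : IsCompact K) :
    {g : H | ((g • K) ∩ K).Nonempty}.Finite :=
  ProperlyDiscontinuousSMul.finite_disjoint_inter_image hK hK

theorem dist_le_of_ediam_le {W : Set X} {δ : ℝ} (hδ : 0 ≤ δ)
    (hW : Metric.ediam W ≤ ENNReal.ofReal δ) {x y : X} (hx : x ∈ W) (hy : y ∈ W) :
    dist x y ≤ δ := by
  have h := (Metric.edist_le_ediam_of_mem hx hy).trans hW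
  rwa [edist_dist, ENNReal.ofReal_le_ofReal_iff hδ] at h

/-- If translates of small sets that meet `K` have a common point, then the corresponding
translates of `K` intersect. -/
theorem inter_nonempty_of_mem_smul [IsIsometricSMul H X] {K : Set X} {δ : ℝ} (hδ : 0 ≤ δ)
    (hsep : ∀ h : H, (h • K) ∩ K = ∅ → 2 * δ < sInf {r | ∃ p ∈ K, ∃ q ∈ h • K, r = dist p q})
    {W W' : Set X} (hW : Metric.ediam W ≤ ENNReal.ofReal δ)
    (hW' : Metric.ediam W' ≤ ENNReal.ofReal δ) (hWK : (W ∩ K).Nonempty) (hWK' : (W' ∩ K).Nonempty)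
    {h h' : H} {t : X} (ht : t ∈ h • W) (ht' : t ∈ h' • W') :
    (((h⁻¹ * h') • K) ∩ K).Nonempty := by
  obtain ⟨k, hkW, hkK⟩ := hWK
  obtain ⟨k', hkW', hkK'⟩ := hWK'
  obtain ⟨x, hx, rfl⟩ := ht
  obtain ⟨y, hy, hxy⟩ := ht'
  simp only at hxy
  refine inter_nonempty_of_dist_le hsep hkK hkK' ?_
  have h1 : dist k x ≤ δ := dist_le_of_ediam_le hδ hW hkW hx
  have h2 : dist y k' ≤ δ := dist_le_of_ediam_le hδ hW' hy hkW'
  have h3 : x = (h⁻¹ * h') • y := by rw [mul_smul, hxy, inv_smul_smul]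
  rw [← dist_smul (h⁻¹ * h') y, ← h3] at h2
  linarith [dist_triangle k x ((h⁻¹ * h') • k')]

/-- By properness only finitely many translates of K meet K, so the supremum defining `relDiam` is
over a bounded set and is a genuine upper bound. -/
theorem dist_le_relDiam [IsIsometricSMul H X] [ProperlyDiscontinuousSMul H X] {K Kout : Set X}
    (hK : IsCompact K) (hKout : IsCompact Kout) {g : H} (hg : ((g • K) ∩ K).Nonempty) {p q : X}
    (hp : p ∈ Kout) (hq : q ∈ Kout) : dist p (g • q) ≤ relDiam H K Kout := by
  have hbdd : ∀ g : H, Bornology.IsBounded ((g • Kout) ∪ Kout) := fun g =>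
    (hKout.smul g).isBounded.union hKout.isBounded
  refine (Metric.dist_le_diam_of_mem (hbdd g) (Or.inr hp) (Or.inl (smul_mem_smul_set hq))).trans ?_
  refine le_csSup ?_ ⟨g, hg, rfl⟩
  refine (((finite_smul_inter_nonempty (H := H) hK).image
    fun g => Metric.diam ((g • Kout) ∪ Kout)).subset ?_).bddAbove
  rintro _ ⟨g, hg, rfl⟩
  exact ⟨g, hg, rfl⟩

/-- The translates of the members of `U` that meet `K`, as a cover of `D`. -/
def translateCover (H : Type*) [Group H] [MulAction H X] (K : Set X) (U : Set (Set X)) (D : Set X)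
    (i : H × {W // W ∈ U ∧ (W ∩ K).Nonempty}) : Set D :=
  {x | (x : X) ∈ i.1 • (i.2 : Set X)}

/-- If the translates by h and h' share a point, then h⁻¹h' moves K to a set meeting K. Only
finitely many elements do, by properness. -/
theorem isStarFiniteCover_translateCover [IsIsometricSMul H X] [ProperlyDiscontinuousSMul H X]
    {K D : Set X} {δ : ℝ} {U : Set (Set X)} (hδ : 0 ≤ δ) (hK : IsCompact K) (hD : D ⊆ orbitSet H K)
    (hsep : ∀ h : H, (h • K) ∩ K = ∅ → 2 * δ < sInf {r | ∃ p ∈ K, ∃ q ∈ h • K, r = dist p q})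
    (hU : IsSmallCover K δ U) : IsStarFiniteCover (translateCover H K U D) := by
  refine ⟨fun i => ?_, fun t => ?_, fun i => ?_⟩
  · exact ((hU.isOpen _ i.2.2.1).smul i.1).preimage continuous_subtype_val
  · obtain ⟨h, k, hk, hkt⟩ := mem_iUnion.1 (hD t.2)
    obtain ⟨W, hW, hkW⟩ := hU.covers hk
    exact ⟨(h, ⟨W, hW, k, hkW, hk⟩), k, hkW, hkt⟩
  · have : Finite {W // W ∈ U ∧ (W ∩ K).Nonempty} := (hU.finite.subset fun W hW => hW.1).to_subtype
    refine (((finite_smul_inter_nonempty (H := H) hK).image (i.1 * ·)).prod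
      (finite_univ (α := {W // W ∈ U ∧ (W ∩ K).Nonempty}))).subset ?_
    rintro j ⟨t, hi, hj⟩
    refine ⟨⟨i.1⁻¹ * j.1, ?_, by simp⟩, mem_univ _⟩
    exact inter_nonempty_of_mem_smul hδ hsep (hU.ediam_le _ i.2.2.1) (hU.ediam_le _ j.2.2.1)
      i.2.2.2 j.2.2.2 hi hj

end Nerve

/-! ### Pushing the boundary off the neighbourhood -/

section PushOff

variable {X : Type*} [MetricSpace X]

theorem infDist_smul_of_smul_eq {H : Type*} [Group H] [MulAction H X] [IsIsometricSMul H X]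
    {C : Set X} (hC : ∀ h : H, h • C = C) (h : H) (x : X) :
    Metric.infDist (h • x) C = Metric.infDist x C := by
  conv_lhs => rw [← hC h]
  exact Metric.infDist_image (isometry_smul X h)

/-- If the geodesics from the points of `S` to their images under `f` move away from `C`, then
`f`, followed by the retraction to the boundary, is homotopic to the inclusion. -/
theorem homotopic_retr_comp (hX : IsCAT0 X) {C : Set X} (hC : SegConvex C) (hP : HasProj C)
    (hne : C.Nonempty) {ε : ℝ} (hε : 0 < ε) {S : Set X}
    (hSF : S ⊆ frontier (Metric.cthickening ε C)) {R : C(((Metric.cthickening ε C)ᶜ : Set X),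
      frontier (Metric.cthickening ε C))} (hR : ∀ x, (R x : X) = retr C ε x)
    (f : C(S, ((Metric.cthickening ε C)ᶜ : Set X)))
    (hf : ∀ q : S, ∀ t ∈ Ioc (0 : ℝ) 1, ε < Metric.infDist (seg (q : X) (f q) t) C) :
    (⟨inclusion hSF, continuous_inclusion hSF⟩ :
      C(S, frontier (Metric.cthickening ε C))).Homotopic (R.comp f) := by
  have hcont : Continuous fun p : unitInterval × S => seg (p.2 : X) (f p.2) p.1 :=
    continuous_seg hX (by fun_prop) (by fun_prop) (by fun_prop) fun p => p.1.2
  have hq : ∀ q : S, Metric.infDist (q : X) C = ε := fun q =>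
    infDist_eq_of_mem_frontier hne hε.le (hSF q.2)
  have hcases : ∀ p : unitInterval × S, seg (p.2 : X) (f p.2) p.1 = p.2 ∨
      ε < Metric.infDist (seg (p.2 : X) (f p.2) p.1) C := by
    rintro ⟨t, q⟩
    rcases t.2.1.eq_or_lt with h | h
    · left
      simp only [← h, seg_zero hX]
    · exact Or.inr (hf q t ⟨h, t.2.2⟩)
  have hge : ∀ p : unitInterval × S, ε ≤ Metric.infDist (seg (p.2 : X) (f p.2) p.1) C := fun p => by
    rcases hcases p with h | h
    · rw [h, hq]
    · exact h.le
  have hmem : ∀ p : unitInterval × S, retr C ε (seg (p.2 : X) (f p.2) p.1) ∈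
      frontier (Metric.cthickening ε C) := fun p => by
    rcases hcases p with h | h
    · rw [h, retr_eq_self hX hε (hq _)]
      exact hSF p.2.2
    · exact retr_mem_frontier hX hP hne hε h
  refine ⟨⟨⟨fun p => ⟨_, hmem p⟩, (continuous_retr_comp hX hC hP hε hcont hge).subtype_mk hmem⟩,
    fun q => Subtype.ext ?_, fun q => Subtype.ext ?_⟩⟩
  · change retr C ε (seg (q : X) (f q) 0) = q
    rw [seg_zero hX, retr_eq_self hX hε (hq q)]
  · change retr C ε (seg (q : X) (f q) 1) = R (f q)
    rw [seg_one hX, hR]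

variable {H : Type*} [Group H] [MulAction H X]

/-- Points close to the image of a push-off grid are seen at obtuse angles to `C`. -/
theorem angleTo_gt_of_dist_le {C S Y K Kout : Set X} {ε α δ δ' : ℝ} {U : Set (Set X)}
    {ι : Set X → X} (hα : Real.pi / 2 < α) (hs : IsSmall H C ε S K Kout α δ δ')
    (hU : IsSmallCover K δ U) (hι : IsPushOffGrid H C S Y U α ι) (hιK : ∀ W ∈ U, ι W ∈ Kout)
    {W : Set X} (hW : W ∈ U) (hWK : (W ∩ K).Nonempty) {q x : X} (hqW : q ∈ W) (hqS : q ∈ S)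
    (hx : dist x (ι W) ≤ δ') : Real.pi / 2 < angleTo C q x := by
  obtain ⟨k, hkW, hkK⟩ := hWK
  obtain ⟨q₀, ⟨hq₀W, hq₀S⟩, hang⟩ := hι.angle_ge W ⟨hW, q, hqW, hqS⟩
  have hd : ∀ {x y}, x ∈ W → y ∈ W → dist x y ≤ δ := fun hx hy =>
    dist_le_of_ediam_le hs.pos.le (hU.ediam_le W hW) hx hy
  have hmem : ∀ {y}, y ∈ W → y ∈ Metric.cthickening δ K := fun hy =>
    Metric.mem_cthickening_of_dist_le _ k _ _ hkK (hd hy hkW)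
  have h := hs.angle_le q ⟨hmem hqW, hqS⟩ q₀ ⟨hmem hq₀W, hq₀S⟩ x
    (Metric.mem_cthickening_of_dist_le _ _ _ _ (hιK W hW) hx) (ι W)
    (Metric.self_subset_cthickening Kout (hιK W hW)) (hd hqW hq₀W) hx
  -- The angle is at least α - (α/2 - π/4) = α/2 + π/4, which exceeds π/2.
  linarith [(abs_le.1 h).1]

/-- The vertices of a push-off grid that belong to a common boundary point are close. -/
theorem IsTightOnBoundary.dist_le {S : Set X} {U : Set (Set X)} {δ δ' : ℝ} {ι : Set X → X}
    (hι : IsTightOnBoundary H S U δ δ' ι) (hS : ∀ h : H, h • S = S) {W W' : Set X} (hW : W ∈ U)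
    (hW' : W' ∈ U) {h h' : H} {t : X} (htS : t ∈ S) (ht : t ∈ h • W) (ht' : t ∈ h' • W') :
    dist (ι (h • W)) (ι (h' • W')) ≤ δ' := by
  classical
  have hmeet : ∀ {W : Set X} {h : H}, W ∈ U → t ∈ h • W → h • W ∈ orbitFamily H (meeting S U) := by
    intro W h hW ht
    refine ⟨h, W, ⟨hW, h⁻¹ • t, mem_smul_set_iff_inv_smul_mem.1 ht, ?_⟩, rfl⟩
    rw [← hS h] at htS
    exact mem_smul_set_iff_inv_smul_mem.1 htS
  have hσ : IsNerveSimplex (orbitFamily H (meeting S U)) ({h • W, h' • W'} : Finset (Set X)) := by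
    refine ⟨Finset.insert_nonempty _ _, ?_, t, ?_⟩
    · intro V hV
      simp only [Finset.coe_insert, Finset.coe_singleton, mem_insert_iff, mem_singleton_iff] at hV
      rcases hV with rfl | rfl
      exacts [hmeet hW ht, hmeet hW' ht']
    · intro V hV
      simp only [Finset.coe_insert, Finset.coe_singleton, mem_insert_iff, mem_singleton_iff] at hV
      rcases hV with rfl | rfl
      exacts [ht, ht']
  refine (Metric.dist_le_diam_of_mem ?_ ?_ ?_).trans (hι.2 _ hσ)
  · exact ((Finset.finite_toSet _).image ι).isBounded
  · exact mem_image_of_mem _ (by simp)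
  · exact mem_image_of_mem _ (by simp)

end PushOff

end CATZero

/-! ### Assembling the proof -/

theorem theoremA {X : Type*} [MetricSpace X] (hX : CATZero.IsCAT0 X)
    {H : Type*} [Group H] [MulAction H X] [IsIsometricSMul H X] [ProperlyDiscontinuousSMul H X]
    (hfree : ∀ (h : H) (x : X), h • x = x → h = 1)
    (C : Set X) (hCclosed : IsClosed C) (hCconvex : CATZero.IsGeodesicallyConvex C)
    (hCinv : ∀ h : H, h • C = C)
    (hCcocompact : ∃ K₀ : Set X, IsCompact K₀ ∧ CATZero.orbitSet H K₀ = C)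
    (ε : ℝ) (hε : 0 < ε)
    (S : Set X) (hS : CATZero.IsComponentOf S (frontier (Metric.cthickening ε C)))
    (hSinv : ∀ h : H, h • S = S)
    (Y : Set X) (hY : CATZero.IsComplementComponent (Metric.cthickening ε C) S Y)
    (hbary : ∃ lam ∈ Ico (1 / 2 : ℝ) 1, CATZero.HasBarycentersUpTo H C ε S Y lam) :
    ContractibleSpace S := by
  open CATZero in
  have hSF : S ⊆ frontier (Metric.cthickening ε C) := by
    obtain ⟨x, -, rfl⟩ := hS
    exact connectedComponentIn_subset _ _
  obtain ⟨s₀, hs₀⟩ : S.Nonempty := by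
    obtain ⟨x, hx, rfl⟩ := hS
    exact ⟨x, mem_connectedComponentIn hx⟩
  have hne : C.Nonempty := by
    rw [nonempty_iff_ne_empty]
    rintro rfl
    simpa using hSF hs₀
  have hC : SegConvex C := hCconvex.segConvex hX
  -- X need not be complete; completeness of C comes from the cocompact action.
  have hP : HasProj C := by
    obtain ⟨K₀, hK₀, hK₀C⟩ := hCcocompact
    exact exists_dist_eq_infDist hX hC (hK₀C ▸ isComplete_orbitSet hfree hK₀) hne
  obtain ⟨lam, ⟨hlam0, hlam1⟩, K, Kout, α, δ, δ', U, hK, -, hKD, hKout, -, hα, hs, hU,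
    ⟨Z, Y', hY', -, -, hZout, hZY, hZ⟩, ι, hι, htight, hιK, -⟩ := hbary
  have hlam : 0 ≤ lam := by linarith
  set D := Metric.cthickening ε C with hD
  have hSD : S ⊆ D := hSF.trans Metric.isClosed_cthickening.frontier_subset
  have hmemD : ∀ {x}, x ∈ D ↔ Metric.infDist x C ≤ ε := mem_cthickening_iff hne hε.le
  have hmemDc : ∀ {x}, x ∈ Dᶜ ↔ ε < Metric.infDist x C := by
    intro x; rw [mem_compl_iff, hmemD, not_le]
  -- Points of Z are farther than ε + δ' from C.
  have hball : ∀ z ∈ Z, Metric.closedBall z δ' ⊆ Dᶜ := by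
    intro z hz x hx
    obtain ⟨y, -, rfl⟩ := hY'
    have h1 := connectedComponentIn_subset _ _ (hZY hz)
    rw [mem_compl_iff, mem_cthickening_iff hne (by linarith [hs.pos']), not_le] at h1
    rw [hmemDc]
    rw [Metric.mem_closedBall, dist_comm] at hx
    linarith [Metric.infDist_le_infDist_add_dist (s := C) (x := z) (y := x)]
  let v : H × {W // W ∈ U ∧ (W ∩ K).Nonempty} → X := fun i => ι (i.1 • (i.2 : Set X))
  have hv_eq : ∀ i, v i = i.1 • ι i.2 := fun i =>
    hι.equivariant i.1 _ ⟨1, _, i.2.2.1, (one_smul H _).symm⟩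
  have hvZ : ∀ i, v i ∈ Z := fun i => by
    rw [hv_eq]
    exact hZout (mem_iUnion.2 ⟨i.1, smul_mem_smul_set (hιK _ i.2.2.1)⟩)
  have hcover : IsStarFiniteCover (translateCover H K U D) :=
    isStarFiniteCover_translateCover hs.pos.le hK hKD.ge hs.separated hU
  -- The same indices and vertices serve S and D, so f and its filling are controlled by compatible
  -- covers.
  have hcoverS : IsStarFiniteCover (translateCover H K U S) :=
    isStarFiniteCover_translateCover hs.pos.le hK (hSD.trans hKD.ge) hs.separated hU
  have hvE : ∀ (t : D) i k, t ∈ translateCover H K U D i → t ∈ translateCover H K U D k →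
      dist (v i) (v k) ≤ relDiam H K Kout := by
    intro t i k hi hk
    have hg := inter_nonempty_of_mem_smul hs.pos.le hs.separated (hU.ediam_le _ i.2.2.1)
      (hU.ediam_le _ k.2.2.1) i.2.2.2 k.2.2.2 hi hk
    have h := dist_le_relDiam hK hKout hg (hιK _ i.2.2.1) (hιK _ k.2.2.1)
    rwa [← dist_smul i.1, ← mul_smul, mul_inv_cancel_left, ← hv_eq, ← hv_eq] at h
  have hvS : ∀ (t : S) i k, t ∈ translateCover H K U S i → t ∈ translateCover H K U S k →
      dist (v i) (v k) ≤ δ' := fun t i k hi hk =>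
    htight.dist_le hSinv i.2.2.1 k.2.2.1 t.2 hi hk
  obtain ⟨f₀, hf₀c, hf₀⟩ := hcoverS.exists_continuous hX v
  have hf₀ball : ∀ t i, t ∈ translateCover H K U S i → f₀ t ∈ Metric.closedBall (v i) δ' :=
    fun t i hi => hf₀ t _ (segConvex_closedBall hX _ _) fun k hk => hvS t k i hk hi
  have hf₀D : ∀ t, f₀ t ∈ Dᶜ := fun t => by
    obtain ⟨i, hi⟩ := hcoverS.covers t
    exact hball _ (hvZ i) (hf₀ball t i hi)
  let f : C(S, (Dᶜ : Set X)) := ⟨fun t => ⟨f₀ t, hf₀D t⟩, hf₀c.subtype_mk hf₀D⟩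
  let R : C((Dᶜ : Set X), frontier D) :=
    ⟨fun x => ⟨retr C ε x, retr_mem_frontier hX hP hne hε (hmemDc.1 x.2)⟩,
      (continuous_retr_comp hX hC hP hε continuous_subtype_val
        fun x => (hmemDc.1 x.2).le).subtype_mk _⟩
  have hpush : ∀ q : S, ∀ t ∈ Ioc (0 : ℝ) 1, ε < Metric.infDist (seg (q : X) (f q) t) C := by
    intro q t ht
    have ht' : t ∈ Icc (0 : ℝ) 1 := ⟨ht.1.le, ht.2⟩
    have hqε : Metric.infDist (q : X) C = ε := infDist_eq_of_mem_frontier hne hε.le (hSF q.2)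
    obtain ⟨i, hi⟩ := hcoverS.covers q
    set x := f₀ q with hx
    have hqx : 0 < dist (q : X) x := dist_pos.2 fun h => hf₀D q (by
      rw [← hx, ← h]; exact hSD q.2)
    -- The angle conditions hold only near K, so the point is moved back to the untranslated cover
    -- member; distances to C are invariant.
    have hang : Real.pi / 2 < angleTo C (i.1⁻¹ • (q : X)) (i.1⁻¹ • x) := by
      refine angleTo_gt_of_dist_le hα hs hU hι hιK i.2.2.1 i.2.2.2
        (mem_smul_set_iff_inv_smul_mem.1 hi) ?_ ?_
      · rw [← mem_smul_set_iff_inv_smul_mem, hSinv]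
        exact q.2
      · rw [← dist_smul i.1, smul_inv_smul, ← hv_eq]
        exact hf₀ball q i hi
    have h := infDist_lt_of_angleTo hX hC hP (y := i.1⁻¹ • seg (q : X) x t)
      (by rwa [infDist_smul_of_smul_eq hCinv, hqε]) hang
      (by
        rw [Ne, smul_left_cancel_iff]
        intro h
        have h' := dist_left_seg hX (q : X) x ht'
        rw [h, dist_self] at h'
        exact (mul_pos ht.1 hqx).ne h')
      (by
        rw [dist_smul, dist_smul, dist_smul, dist_left_seg hX _ _ ht', dist_seg_right hX _ _ ht']
        ring)
    rwa [infDist_smul_of_smul_eq hCinv, infDist_smul_of_smul_eq hCinv, hqε] at h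
  -- The number of subdivisions that brings all vertex distances down to δ'.
  obtain ⟨n, hn⟩ : ∃ n : ℕ, lam ^ n * relDiam H K Kout ≤ δ' := by
    have hlim := (tendsto_pow_atTop_nhds_zero_of_lt_one hlam hlam1).mul_const (relDiam H K Kout)
    rw [zero_mul] at hlim
    exact (hlim.eventually_le_const hs.pos').exists
  let j : C(S, D) := ⟨inclusion hSD, continuous_inclusion hSD⟩
  obtain ⟨i₀, -⟩ := hcoverS.covers ⟨s₀, hs₀⟩
  obtain ⟨G, hG⟩ := exists_filling hX hlam hlam1.le hZ ⟨v i₀, hvZ i₀⟩ hball j n hcover hvZ hvE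
    le_rfl hn (fun a i k hi hk => hvS a i k hi hk) f fun a B hB h => hf₀ a B hB h
  have hDconvex : SegConvex D := fun x hx y hy t ht => by
    rw [hmemD] at *
    nlinarith [infDist_seg_le hX hC hP x y ht, ht.1, ht.2]
  have : ContractibleSpace D := contractibleSpace_of_segConvex hX hDconvex ⟨s₀, hSD hs₀⟩
  refine contractibleSpace_of_nullhomotopic_inclusion hS hSF ?_
  obtain ⟨c, hc⟩ : ((R.comp G).comp j).Nullhomotopic :=
    (((id_nullhomotopic D).comp_right (R.comp G)).comp_left j)
  refine ⟨c, ?_⟩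
  have h1 := homotopic_retr_comp hX hC hP hne hε hSF (R := R) (fun _ => rfl) f hpush
  have h2 : (R.comp (G.comp j)).Homotopic (R.comp f) := .comp (.refl R) hG
  exact h1.trans (h2.symm.trans hc)
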